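/- **Proposition 6.4.** Let $m\in\mathbb N$ and let $E_0,E_1\in C^\infty(\mathbb R^m;\mathbb R)$ be two energy surfaces with bounded second derivatives: there is a constant $C_E$ with $\sup_{q\in\mathbb R^m}|\partial^\alpha E_k(q)|\le C_E$ for all $|\alpha|=2$ and $k\in\{0,1\}$. Let $i\in\{0,1\}$ (initial surface), $t\ge 0$, and let $T=(t_1,\dots,t_j)$, $j\ge 0$, be any hopping time sequence $0\le t_1\le\cdots\le t_j$ (hopping times beyond $t$, if any, play no role). For $z=(q,p)\in\mathbb R^{2m}$ let $(Q,P,S)$ be the continuous solution with $(Q,P,S)|_{s=0}=(q,p,0)$ of the piecewise Hamiltonian system $$\frac{dQ}{ds}=P,\qquad \frac{dP}{ds}=-\nabla E_{l}(Q),\qquad \frac{dS}{ds}=\tfrac12|P|^2-E_{l}(Q),$$ where the surface index $l$ equals $i$ until $t_1$ and switches to the other element of $\{0,1\}$ at each hopping time $t_k$. Write $Q,P,S$ for the values at $s=t$, as functions of $z$, let $\kappa_{t,T}(q,p)=(Q,P)$, and put $$\Phi(t,x,y,z)=S+\tfrac i2|x-Q|^2+P\cdot(x-Q)+\tfrac i2|y-q|^2-p\cdot(y-q)$$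 (here the factor $i$ is the imaginary unit). For $\varepsilon>0$, $M\in L^\infty(\mathbb R^{2m};\mathbb C)$ and $u\in\mathcal S(\mathbb R^m;\mathbb C)$ define $$\bigl(\mathcal I^{\varepsilon}_{\kappa_{t,T}}(M)u\bigr)(x)=(2\pi\varepsilon)^{-3m/2}\int_{\mathbb R^{2m}}\Bigl(\int_{\mathbb R^m}e^{\frac i\varepsilon\Phi(t,x,y,z)}M(z)u(y)\,dy\Bigr)dz .$$ Then, for every $u \in \mathcal S(\mathbb R^m;\mathbb C)$ and every $x$, the inner integral converges absolutely for every $z$ and is an integrable function of $z$, and $\mathcal I^{\varepsilon}_{\kappa_{t,T}}(M)$ extends from $\mathcal S(\mathbb R^m;\mathbb C)$ to a bounded linear operator on $L^2(\mathbb R^m;\mathbb C)$ with $$\bigl\|\mathcal I^{\varepsilon}_{\kappa_{t,T}}(M)\bigr\|_{\mathcal L(L^2(\mathbb R^m;\mathbb C))}\le 2^{-m/2}\,\|M\|_{L^\infty(\mathbb R^{2m};\mathbb C)} .$$ -/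

import Mathlib

open MeasureTheory
open scoped ContDiff ENNReal SchwartzMap

noncomputable section

/-- Configuration space `ℝ^m` with its Euclidean norm and Lebesgue measure. -/
abbrev ConfSpace (m : ℕ) : Type := EuclideanSpace ℝ (Fin m)

/-- Phase space `ℝ^{2m}`; a point is `z = (q, p)`. -/
abbrev PhaseSpace (m : ℕ) : Type := ConfSpace m × ConfSpace m

/-- Values `(Q, P, S)` of the FGA variables: position, momentum, action. -/
abbrev FGAState (m : ℕ) : Type := ConfSpace m × ConfSpace m × ℝ

/-- The `a`-th standard unit vector of `ℝ^m`. -/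
def unitVec {m : ℕ} (a : Fin m) : ConfSpace m := EuclideanSpace.single a (1 : ℝ)

/-- A smooth energy surface all of whose second partial derivatives are bounded by `C` on the
whole of `ℝ^m` (the subquadratic condition). -/
def IsSubquadratic {m : ℕ} (V : ConfSpace m → ℝ) (C : ℝ) : Prop :=
  ContDiff ℝ ∞ V ∧
    ∀ (q : ConfSpace m) (a b : Fin m), |iteratedFDeriv ℝ 2 V q ![unitVec a, unitVec b]| ≤ C

/-- `γ = (Q, P, S)` solves `Q' = P`, `P' = -∇V(Q)`, `S' = |P|²/2 - V(Q)` for all times. -/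
def IsSurfaceTrajectory {m : ℕ} (V : ConfSpace m → ℝ) (γ : ℝ → FGAState m) : Prop :=
  ∀ s : ℝ, HasDerivAt γ
    ((γ s).2.1, -gradient V (γ s).1, ‖(γ s).2.1‖ ^ 2 / 2 - V (γ s).1) s

open Classical in
/-- The flow of `(Q, P, S)` on a single energy surface: the value at time `s` of the solution of
the evolution equations that starts from `w` at time `0`. For a subquadratic surface the vector
field `(P, -∇V(Q))` is globally Lipschitz, so a solution exists for all times and is unique, and
the `else` branch never occurs. -/
def surfaceFlow {m : ℕ} (V : ConfSpace m → ℝ) (s : ℝ) (w : FGAState m) : FGAState m :=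
  if h : ∃ γ : ℝ → FGAState m, γ 0 = w ∧ IsSurfaceTrajectory V γ then h.choose s else w

/-- The FGA variables at time `t` with surface hopping: the state is `w` at time `a`, the current
energy surface is `l`, and the list holds the remaining hopping times in increasing order. Up to
the next hopping time the state follows the flow of the surface `l`; there it continues,
continuously in time, on the other surface `l + 1` (mod 2). Hopping times beyond `t` play no
role. -/
def hopState {m : ℕ} (E : Fin 2 → ConfSpace m → ℝ) (t : ℝ) :
    List ℝ → Fin 2 → ℝ → FGAState m → FGAState m
  | [], l, a, w => surfaceFlow (E l) (t - a) w
  | t₁ :: ts, l, a, w =>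
      if t ≤ t₁ then surfaceFlow (E l) (t - a) w
      else hopState E t ts (l + 1) t₁ (surfaceFlow (E l) (t₁ - a) w)

/-- The FGA variables `(Q, P, S)(t, T, z)` of the trajectory that starts at time `0` from
`z = (q, p)` on the energy surface `i`, with zero action, and hops at the times in `T`. -/
def fgaVars {m : ℕ} (E : Fin 2 → ConfSpace m → ℝ) (i : Fin 2) (t : ℝ) (T : List ℝ)
    (z : PhaseSpace m) : FGAState m :=
  hopState E t T i 0 (z.1, z.2, 0)

/-- The phase space map `κ_{t,T} : (q, p) ↦ (Q, P)`. -/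
def fgaMap {m : ℕ} (E : Fin 2 → ConfSpace m → ℝ) (i : Fin 2) (t : ℝ) (T : List ℝ)
    (z : PhaseSpace m) : PhaseSpace m :=
  ((fgaVars E i t T z).1, (fgaVars E i t T z).2.1)

/-- The action `S(t, T, z)`. -/
def fgaAction {m : ℕ} (E : Fin 2 → ConfSpace m → ℝ) (i : Fin 2) (t : ℝ) (T : List ℝ)
    (z : PhaseSpace m) : ℝ :=
  (fgaVars E i t T z).2.2

/-- The complex phase
`Φ = S + (i/2)|x - Q|² + P·(x - Q) + (i/2)|y - q|² - p·(y - q)`. -/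
def fgaPhase {m : ℕ} (E : Fin 2 → ConfSpace m → ℝ) (i : Fin 2) (t : ℝ) (T : List ℝ)
    (x y : ConfSpace m) (z : PhaseSpace m) : ℂ :=
  (fgaAction E i t T z : ℂ)
    + Complex.I / 2 * ((‖x - (fgaMap E i t T z).1‖ ^ 2 : ℝ) : ℂ)
    + ((inner ℝ (fgaMap E i t T z).2 (x - (fgaMap E i t T z).1) : ℝ) : ℂ)
    + Complex.I / 2 * ((‖y - z.1‖ ^ 2 : ℝ) : ℂ)
    - ((inner ℝ z.2 (y - z.1) : ℝ) : ℂ)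

/-- The result of the integration over `y`, as a function of `z`, in the Fourier integral
operator: `∫ exp((i/ε) Φ(t,x,y,z)) M(z) u(y) dy`. -/
def fgaInner {m : ℕ} (E : Fin 2 → ConfSpace m → ℝ) (i : Fin 2) (t : ℝ) (T : List ℝ) (ε : ℝ)
    (M : PhaseSpace m → ℂ) (u : ConfSpace m → ℂ) (x : ConfSpace m) (z : PhaseSpace m) : ℂ :=
  ∫ y : ConfSpace m, Complex.exp (Complex.I / (ε : ℂ) * fgaPhase E i t T x y z) * M z * u y

/-- The FGA Fourier integral operator
`(2πε)^{-3m/2} ∫∫ exp((i/ε) Φ(t,x,y,z)) M(z) u(y) dy dz`. For bounded `M` the integrand need not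
be absolutely integrable in `(y, z)` jointly (it has no decay in `p`), so the integral is
read as the iterated one, first in `y` and then in `z`. -/
def fgaFIO {m : ℕ} (E : Fin 2 → ConfSpace m → ℝ) (i : Fin 2) (t : ℝ) (T : List ℝ) (ε : ℝ)
    (M : PhaseSpace m → ℂ) (u : ConfSpace m → ℂ) (x : ConfSpace m) : ℂ :=
  (((2 * Real.pi * ε) ^ (-(3 * (m : ℝ) / 2)) : ℝ) : ℂ)
    * ∫ z : PhaseSpace m, fgaInner E i t T ε M u x z

end

/-!
The operator factors through phase space. Let `fbiTransform` pair `u` with the coherent states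
`g_z(y) = exp((i/ε)((i/2)|y - q|² + p·(y - q)))`, `z = (q, p)`. Since the phase `Φ` splits,

  `∫ exp((i/ε) Φ(t,x,y,z)) M(z) u(y) dy = exp(i S(z)/ε) g_{κ z}(x) · M(z) (fbiTransform u)(z)`,

so that up to the factor `(2πε)^{-3m/2}` the operator is `T₂* T₁`, where `T₁ u = M · fbiTransform u`
and `T₂ v = exp(-i S/ε) · (fbiTransform v) ∘ κ`. By Plancherel in `p` and a Gaussian integral in `q`,
`‖fbiTransform u‖² = (2πε)^m (πε)^{m/2} ‖u‖²` (`integral_norm_sq_fbiTransform`). If composition with `κ`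
does not increase `L²` norms on phase space, this gives the norm bound
`(2πε)^{-3m/2} (2πε)^m (πε)^{m/2} ‖M‖_∞ = 2^{-m/2} ‖M‖_∞`
(`exists_clm_integral_phasedCoherentState`, `rpow_mul_fbiNormSq`).

Absolute convergence of the integral over `z` holds because `fbiTransform u` decays rapidly for
Schwartz `u`: multiplying it by `qₐ - i pₐ` amounts to replacing `u` by `(yₐ - ε ∂ₐ) u`
(`exists_mul_fbiTransform_eq`).

It remains that `κ` and `S` are measurable and that `κ` does not increase volume, which is the half of
Liouville's theorem needed here. No derivative of the flow is used. The symplectic Euler scheme is a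
composition of shears, hence measure preserving (`measurePreserving_symplecticEuler`), and it
converges pointwise to the Hamiltonian flow (`tendsto_symplecticEuler_iterate`), because the gradient
of a subquadratic surface is globally Lipschitz. A pointwise limit of measure preserving maps does not
increase volume (`map_le_of_tendsto_measurePreserving`). Both properties pass to compositions, hence
to trajectories with hops (`isVolumeContracting_hopState`).
-/

/-! ### Global solutions and one-step methods for Lipschitz vector fields -/

section ODE

open Filter Topology Set
open scoped NNReal

variable {E : Type*} [NormedAddCommGroup E] [NormedSpace ℝ E]

/-- A globally Lipschitz `C¹` vector field is complete. On the ball of radius `‖v y‖ + 1` about `y`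
the field is bounded by `‖v y‖ + L (‖v y‖ + 1)`, so that the Picard-Lindelöf theorem gives a solution
on a time interval of length independent of `y`. -/
theorem exists_global_integralCurve [CompleteSpace E] {v : E → E} {L : ℝ≥0}
    (hv : LipschitzWith L v) (hv' : ContDiff ℝ 1 v) (x : E) :
    ∃ γ : ℝ → E, γ 0 = x ∧ ∀ s, HasDerivAt γ (v (γ s)) s := by
  have key : ∀ y : E, ∃ γ : ℝ → E, γ 0 = y ∧
      IsMIntegralCurveOn (I := modelWithCornersSelf ℝ E) γ
        (fun z => (v z : TangentSpace (modelWithCornersSelf ℝ E) z))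
        (Ioo (-(1 / (1 + L) : ℝ)) (1 / (1 + L))) := by
    intro y
    set δ : ℝ := 1 / (1 + L) with hδ
    have hδ0 : 0 < δ := by positivity
    let t₀ : Icc (-δ) δ := ⟨0, by constructor <;> linarith⟩
    set a : ℝ≥0 := ‖v y‖₊ + 1 with ha
    have hPL : IsPicardLindelof (fun _ => v) t₀ y a 0 (‖v y‖₊ + L * a) L := by
      refine IsPicardLindelof.of_time_independent ?_ hv.lipschitzOnWith ?_
      · intro z hz
        have h1 : ‖v z - v y‖ ≤ L * ‖z - y‖ := hv.norm_sub_le z y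
        have h2 : ‖z - y‖ ≤ a := by simpa [dist_eq_norm] using hz
        have h3 : ‖v z‖ ≤ ‖v z - v y‖ + ‖v y‖ := by
          simpa using norm_add_le (v z - v y) (v y)
        have h4 : (L : ℝ) * ‖z - y‖ ≤ L * a := by gcongr
        push_cast
        linarith
      · have h0 : ((t₀ : Icc (-δ) δ) : ℝ) = 0 := rfl
        rw [h0]
        simp only [sub_zero, zero_sub, neg_neg, max_self, NNReal.coe_zero]
        rw [hδ, mul_one_div, div_le_iff₀ (by positivity)]
        push_cast [ha]
        have := norm_nonneg (v y)
        have := L.coe_nonneg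
        nlinarith
    obtain ⟨α, hα0, hα⟩ := hPL.exists_eq_forall_mem_Icc_hasDerivWithinAt₀
    refine ⟨α, hα0, fun s hs => ?_⟩
    have := (hα s (Ioo_subset_Icc_self hs)).mono Ioo_subset_Icc_self
    exact this.hasFDerivWithinAt.hasMFDerivWithinAt
  have hsmooth := (contMDiff_vectorSpace_iff_contDiff (V := v)).2 hv'
  obtain ⟨γ, h0, hγ⟩ := exists_isMIntegralCurve_of_isMIntegralCurveOn
    (I := modelWithCornersSelf ℝ E) hsmooth (by positivity) key x
  refine ⟨γ, h0, fun s => ?_⟩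
  have h : HasFDerivAt γ ((1 : ℝ →L[ℝ] ℝ).smulRight (v (γ s)) : ℝ →L[ℝ] E) s := (hγ s).hasFDerivAt
  simpa using h.hasDerivAt

theorem norm_integralCurve_sub_taylor_le {v : E → E} {L : ℝ≥0} (hv : LipschitzWith L v) {γ : ℝ → E}
    (hγ : ∀ s, HasDerivAt γ (v (γ s)) s) {r B : ℝ} (hB : ∀ s ∈ Icc (-r) r, ‖v (γ s)‖ ≤ B)
    {s h : ℝ} (hs : s ∈ Icc (-r) r) (hsh : s + h ∈ Icc (-r) r) :
    ‖γ (s + h) - γ s - h • v (γ s)‖ ≤ L * B * h ^ 2 := by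
  have hsub : uIcc s (s + h) ⊆ Icc (-r) r := uIcc_subset_Icc hs hsh
  have hB0 : 0 ≤ B := (norm_nonneg _).trans (hB s hs)
  have hlip : ∀ σ ∈ uIcc s (s + h), ‖γ σ - γ s‖ ≤ B * |h| := by
    intro σ hσ
    have h1 := (convex_Icc (-r) r).norm_image_sub_le_of_norm_hasDerivWithin_le
      (fun x _ => (hγ x).hasDerivWithinAt) hB hs (hsub hσ)
    refine h1.trans ?_
    have : |σ - s| ≤ |h| := by simpa using abs_sub_left_of_mem_uIcc hσ
    rw [Real.norm_eq_abs]
    gcongr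
  have h2 := (convex_uIcc s (s + h)).norm_image_sub_le_of_norm_hasDerivWithin_le
    (f := fun σ => γ σ - σ • v (γ s)) (f' := fun σ => v (γ σ) - v (γ s)) (C := L * (B * |h|))
    (fun x _ => by
      have := (hγ x).sub ((hasDerivAt_id x).smul_const (v (γ s)))
      rw [one_smul] at this
      exact this.hasDerivWithinAt)
    (fun σ hσ => (hv.norm_sub_le _ _).trans (by gcongr; exact hlip σ hσ))
    left_mem_uIcc right_mem_uIcc
  calc ‖γ (s + h) - γ s - h • v (γ s)‖
      = ‖γ (s + h) - (s + h) • v (γ s) - (γ s - s • v (γ s))‖ := by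
        congr 1; rw [add_smul]; abel
    _ ≤ L * (B * |h|) * ‖s + h - s‖ := h2
    _ = L * B * h ^ 2 := by
        rw [add_sub_cancel_left, Real.norm_eq_abs, ← sq_abs h]; ring

/-- Convergence of a one-step method: if `Φ h` is stable (Lipschitz with constant `1 + K|h|`) and
agrees with `x + h v(x)` up to an error `O(h²)` that grows at most linearly in `x`, then `n` steps of
size `t / n` converge to the solution at time `t`. -/
theorem tendsto_iterate_of_oneStep {v : E → E} {L : ℝ≥0} (hv : LipschitzWith L v)
    {Φ : ℝ → E → E} {K : ℝ} (hK : 0 ≤ K)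
    (hstab : ∀ h x y, |h| ≤ 1 → ‖Φ h x - Φ h y‖ ≤ (1 + K * |h|) * ‖x - y‖)
    (hcons : ∀ h x, ‖Φ h x - x - h • v x‖ ≤ K * h ^ 2 * ‖x‖)
    {γ : ℝ → E} (hγ : ∀ s, HasDerivAt γ (v (γ s)) s) (t : ℝ) :
    Tendsto (fun n : ℕ => (Φ (t / n))^[n] (γ 0)) atTop (𝓝 (γ t)) := by
  have hγc : Continuous γ := continuous_iff_continuousAt.2 fun s => (hγ s).continuousAt
  obtain ⟨B₁, hB₁⟩ := (isCompact_Icc (a := -|t|) (b := |t|)).exists_bound_of_continuousOn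
    (f := γ) hγc.continuousOn
  obtain ⟨B₂, hB₂⟩ := (isCompact_Icc (a := -|t|) (b := |t|)).exists_bound_of_continuousOn
    (f := fun s => v (γ s)) (hv.continuous.comp hγc).continuousOn
  have h0mem : (0 : ℝ) ∈ Icc (-|t|) |t| := by simp
  have hB₁0 : 0 ≤ B₁ := (norm_nonneg _).trans (hB₁ 0 h0mem)
  have hB₂0 : 0 ≤ B₂ := (norm_nonneg _).trans (hB₂ 0 h0mem)
  set C : ℝ := K * B₁ + L * B₂ with hC
  have hC0 : 0 ≤ C := by positivity
  have hbound : ∀ n : ℕ, 1 ≤ n → |t| ≤ n →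
      ‖(Φ (t / n))^[n] (γ 0) - γ t‖ ≤ C * t ^ 2 * Real.exp (K * |t|) * (1 / (n : ℝ)) := by
    intro n hn htn
    have hn0 : (0 : ℝ) < n := by exact_mod_cast hn
    set h : ℝ := t / n with hh
    have hh1 : |h| ≤ 1 := by
      rw [hh, abs_div, Nat.abs_cast, div_le_one hn0]; exact htn
    have hmem : ∀ k : ℕ, k ≤ n → (k : ℝ) * h ∈ Icc (-|t|) |t| := by
      intro k hk
      rw [mem_Icc, ← abs_le, hh, abs_mul, abs_div, Nat.abs_cast, Nat.abs_cast, mul_div_assoc', mul_comm,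
        mul_div_assoc]
      have : (k : ℝ) / n ≤ 1 := by rw [div_le_one hn0]; exact_mod_cast hk
      calc |t| * ((k : ℝ) / n) ≤ |t| * 1 := by gcongr
        _ = |t| := mul_one _
    -- discrete Grönwall estimate for the accumulated error
    have hind : ∀ k : ℕ, k ≤ n →
        ‖(Φ h)^[k] (γ 0) - γ (k * h)‖ ≤ k * (C * h ^ 2) * Real.exp (K * |h| * k) := by
      intro k
      induction k with
      | zero => intro _; simp
      | succ k ih =>
        intro hk
        have ih' := ih (by omega)
        have hm := hmem k (by omega)
        have hm' := hmem (k + 1) hk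
        have hkh : ((k + 1 : ℕ) : ℝ) * h = k * h + h := by push_cast; ring
        rw [hkh] at hm' ⊢
        rw [Function.iterate_succ_apply']
        have e1 := hstab h ((Φ h)^[k] (γ 0)) (γ (k * h)) hh1
        have e2 : ‖Φ h (γ (k * h)) - γ (k * h) - h • v (γ (k * h))‖ ≤ K * h ^ 2 * B₁ :=
          (hcons h (γ (k * h))).trans (by gcongr; exact hB₁ _ hm)
        have e3 := norm_integralCurve_sub_taylor_le hv hγ hB₂ hm hm'
        have e4 : ‖Φ h ((Φ h)^[k] (γ 0)) - γ (k * h + h)‖ ≤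
            ‖Φ h ((Φ h)^[k] (γ 0)) - Φ h (γ (k * h))‖
            + ‖Φ h (γ (k * h)) - γ (k * h) - h • v (γ (k * h))‖
            + ‖γ (k * h + h) - γ (k * h) - h • v (γ (k * h))‖ := by
          refine le_trans (le_of_eq ?_) ((norm_sub_le _ _).trans (add_le_add_left (norm_add_le _ _) _))
          congr 1; abel
        have hexp1 : 1 + K * |h| ≤ Real.exp (K * |h|) := by
          rw [add_comm]; exact Real.add_one_le_exp _
        have hone : 1 ≤ Real.exp (K * |h| * (k + 1 : ℕ)) := Real.one_le_exp (by positivity)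
        have hsplit : Real.exp (K * |h| * (k + 1 : ℕ))
            = Real.exp (K * |h|) * Real.exp (K * |h| * k) := by
          rw [← Real.exp_add]; congr 1; push_cast; ring
        calc ‖Φ h ((Φ h)^[k] (γ 0)) - γ (k * h + h)‖
            ≤ (1 + K * |h|) * (k * (C * h ^ 2) * Real.exp (K * |h| * k)) + C * h ^ 2 := by
              have e5 : (1 + K * |h|) * ‖(Φ h)^[k] (γ 0) - γ (k * h)‖ ≤
                (1 + K * |h|) * (k * (C * h ^ 2) * Real.exp (K * |h| * k)) := by gcongr
              have e6 : C * h ^ 2 = K * h ^ 2 * B₁ + L * B₂ * h ^ 2 := by rw [hC]; ring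
              linarith
          _ ≤ Real.exp (K * |h|) * (k * (C * h ^ 2) * Real.exp (K * |h| * k))
              + C * h ^ 2 * Real.exp (K * |h| * (k + 1 : ℕ)) := by
              refine add_le_add (by gcongr) (le_mul_of_one_le_right (by positivity) hone)
          _ = ((k + 1 : ℕ) : ℝ) * (C * h ^ 2) * Real.exp (K * |h| * (k + 1 : ℕ)) := by
              rw [hsplit]; push_cast; ring
    have hfin := hind n le_rfl
    have hnh : (n : ℝ) * h = t := by rw [hh]; field_simp
    have hnh' : K * |h| * n = K * |t| := by
      rw [← hnh, abs_mul, Nat.abs_cast]; ring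
    rw [hnh, hnh'] at hfin
    refine hfin.trans (le_of_eq ?_)
    rw [hh]; field_simp
  rw [tendsto_iff_norm_sub_tendsto_zero]
  have hlim : Tendsto (fun n : ℕ => C * t ^ 2 * Real.exp (K * |t|) * (1 / (n : ℝ))) atTop (𝓝 0) := by
    simpa using (tendsto_one_div_atTop_nhds_zero_nat (𝕜 := ℝ)).const_mul
      (C * t ^ 2 * Real.exp (K * |t|))
  refine squeeze_zero' (Eventually.of_forall fun _ => norm_nonneg _) ?_ hlim
  obtain ⟨N, hN⟩ := exists_nat_ge |t|
  filter_upwards [eventually_ge_atTop (max N 1)] with n hn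
  exact hbound n ((le_max_right _ _).trans hn)
    (hN.trans (by exact_mod_cast (le_max_left _ _).trans hn))

end ODE

/-! ### The Hamiltonian vector field and the symplectic Euler scheme -/

section Flow

open Filter Topology Set
open scoped NNReal

variable {m : ℕ}

/-- In coordinates, bounds on the second partial derivatives bound the second derivative as a bilinear
form, hence the Lipschitz constant of the gradient. -/
theorem IsSubquadratic.exists_lipschitzWith_gradient {V : ConfSpace m → ℝ} {C : ℝ}
    (hV : IsSubquadratic V C) : ∃ K : ℝ≥0, LipschitzWith K (gradient V) := by
  obtain ⟨hsm, hC⟩ := hV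
  have hd : ContDiff ℝ 1 (fderiv ℝ V) := hsm.fderiv_right (by norm_cast)
  -- the absolute value matters only for `m = 0`, where `C` may be negative
  set K : ℝ := ∑ _a : Fin m, ∑ _b : Fin m, |C| with hK
  have hK0 : 0 ≤ K := by positivity
  have hbound : ∀ q, ‖fderiv ℝ (fderiv ℝ V) q‖ ≤ K := by
    intro q
    refine ContinuousLinearMap.opNorm_le_bound _ hK0 fun u => ?_
    refine ContinuousLinearMap.opNorm_le_bound _ (by positivity) fun w => ?_
    have hexp : ∀ x : ConfSpace m, x = ∑ a, x a • (unitVec a : ConfSpace m) := by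
      intro x
      have := (EuclideanSpace.basisFun (Fin m) ℝ).sum_repr x
      simpa [unitVec, EuclideanSpace.basisFun_apply] using this.symm
    have hcoord : ∀ a b : Fin m, |fderiv ℝ (fderiv ℝ V) q (unitVec a) (unitVec b)| ≤ |C| := by
      intro a b
      have := hC q a b
      rw [iteratedFDeriv_two_apply] at this
      simpa using this.trans (le_abs_self C)
    have hco : ∀ (x : ConfSpace m) a, |x a| ≤ ‖x‖ := fun x a => by
      simpa using PiLp.norm_apply_le x a
    have hval : fderiv ℝ (fderiv ℝ V) q u w = ∑ a, ∑ b,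
        u a * (w b * fderiv ℝ (fderiv ℝ V) q (unitVec a) (unitVec b)) := by
      conv_lhs => rw [hexp u, hexp w]
      simp only [map_sum, map_smul, sum_apply, smul_apply,
        smul_eq_mul, Finset.mul_sum]
      rw [Finset.sum_comm]
      refine Finset.sum_congr rfl fun a _ => Finset.sum_congr rfl fun b _ => by ring
    rw [hval, hK, Finset.sum_mul, Finset.sum_mul, Real.norm_eq_abs]
    refine (Finset.abs_sum_le_sum_abs _ _).trans (Finset.sum_le_sum fun a _ => ?_)
    rw [Finset.sum_mul, Finset.sum_mul]
    refine (Finset.abs_sum_le_sum_abs _ _).trans (Finset.sum_le_sum fun b _ => ?_)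
    rw [abs_mul, abs_mul]
    calc |u a| * (|w b| * |fderiv ℝ (fderiv ℝ V) q (unitVec a) (unitVec b)|)
        ≤ ‖u‖ * (‖w‖ * |C|) := by
          exact mul_le_mul (hco u a) (mul_le_mul (hco w b) (hcoord a b) (abs_nonneg _)
            (norm_nonneg _)) (by positivity) (norm_nonneg _)
      _ = |C| * ‖u‖ * ‖w‖ := by ring
  refine ⟨⟨K, hK0⟩, ?_⟩
  have h1 : LipschitzWith ⟨K, hK0⟩ (fderiv ℝ V) :=
    lipschitzWith_of_nnnorm_fderiv_le (𝕜 := ℝ) (hd.differentiable one_ne_zero) fun q => hbound q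
  have h2 := (InnerProductSpace.toDual ℝ (ConfSpace m)).symm.lipschitz.comp h1
  exact h2.weaken (one_mul _).le

theorem IsSubquadratic.contDiff_gradient {V : ConfSpace m → ℝ} {C : ℝ}
    (hV : IsSubquadratic V C) : ContDiff ℝ 1 (gradient V) :=
  (InnerProductSpace.toDual ℝ (ConfSpace m)).symm.toContinuousLinearEquiv.contDiff.comp
    (hV.1.fderiv_right (by norm_cast))

/-- The Hamiltonian vector field `(p, -∇V(q))` of `|p|²/2 + V(q)`. -/
noncomputable def hamiltonianField (V : ConfSpace m → ℝ) (z : PhaseSpace m) : PhaseSpace m :=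
  (z.2, -gradient V z.1)

theorem lipschitzWith_hamiltonianField {V : ConfSpace m → ℝ} {K : ℝ≥0}
    (hK : LipschitzWith K (gradient V)) : LipschitzWith (max 1 K) (hamiltonianField V) := by
  have h2 : LipschitzWith K fun z : PhaseSpace m => -gradient V z.1 := by
    have := hK.comp (LipschitzWith.prod_fst (α := ConfSpace m) (β := ConfSpace m))
    rw [mul_one] at this
    exact this.neg
  exact LipschitzWith.prod_snd.prodMk h2

theorem IsSubquadratic.contDiff_hamiltonianField {V : ConfSpace m → ℝ} {C : ℝ}
    (hV : IsSubquadratic V C) : ContDiff ℝ 1 (hamiltonianField V) :=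
  contDiff_snd.prodMk (hV.contDiff_gradient.comp contDiff_fst).neg

/-- One step of size `h` of the symplectic Euler scheme: a drift `q ↦ q + h p` followed by a kick
`p ↦ p - h ∇V(q)`. -/
noncomputable def symplecticEuler (V : ConfSpace m → ℝ) (h : ℝ) (z : PhaseSpace m) :
    PhaseSpace m :=
  (z.1 + h • z.2, z.2 - h • gradient V (z.1 + h • z.2))

/-- Both substeps of the scheme are shears, and a shear preserves the product measure. -/
theorem measurePreserving_symplecticEuler {V : ConfSpace m → ℝ} (hV : Continuous (gradient V))
    (h : ℝ) : MeasurePreserving (symplecticEuler V h) := by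
  have hkick : MeasurePreserving (fun z : PhaseSpace m => (z.1, z.2 - h • gradient V z.1)) :=
    (MeasurePreserving.id (volume : Measure (ConfSpace m))).skew_product
      (g := fun q p => p - h • gradient V q)
      (by
        have : Continuous (fun z : PhaseSpace m => z.2 - h • gradient V z.1) := by fun_prop
        exact this.measurable)
      (Eventually.of_forall fun q => (measurePreserving_sub_right volume _).map_eq)
  have hshear : MeasurePreserving (fun z : PhaseSpace m => (z.1, z.2 + h • z.1)) :=
    (MeasurePreserving.id (volume : Measure (ConfSpace m))).skew_product
      (g := fun q p => p + h • q)
      (by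
        have : Continuous (fun z : PhaseSpace m => z.2 + h • z.1) := by fun_prop
        exact this.measurable)
      (Eventually.of_forall fun q => (measurePreserving_add_right volume _).map_eq)
  have hswap : MeasurePreserving (Prod.swap : PhaseSpace m → PhaseSpace m) :=
    Measure.measurePreserving_swap
  exact hkick.comp (hswap.comp (hshear.comp hswap))

theorem norm_symplecticEuler_sub_le {V : ConfSpace m → ℝ} {K : ℝ≥0}
    (hK : LipschitzWith K (gradient V)) {h : ℝ} (hh : |h| ≤ 1) (x y : PhaseSpace m) :
    ‖symplecticEuler V h x - symplecticEuler V h y‖ ≤ (1 + (1 + 2 * K) * |h|) * ‖x - y‖ := by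
  have h1 : ‖x.1 - y.1‖ ≤ ‖x - y‖ := norm_fst_le (x - y)
  have h2 : ‖x.2 - y.2‖ ≤ ‖x - y‖ := norm_snd_le (x - y)
  have hK0 := K.coe_nonneg
  have hn := norm_nonneg (x - y)
  have hq : ‖x.1 + h • x.2 - (y.1 + h • y.2)‖ ≤ (1 + |h|) * ‖x - y‖ := by
    calc ‖x.1 + h • x.2 - (y.1 + h • y.2)‖ = ‖(x.1 - y.1) + h • (x.2 - y.2)‖ := by
          congr 1; rw [smul_sub]; abel
      _ ≤ ‖x.1 - y.1‖ + |h| * ‖x.2 - y.2‖ := by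
          simpa [norm_smul] using norm_add_le (x.1 - y.1) (h • (x.2 - y.2))
      _ ≤ ‖x - y‖ + |h| * ‖x - y‖ := by gcongr
      _ = _ := by ring
  have hp : ‖x.2 - h • gradient V (x.1 + h • x.2) - (y.2 - h • gradient V (y.1 + h • y.2))‖
      ≤ ‖x - y‖ + |h| * (K * ((1 + |h|) * ‖x - y‖)) := by
    calc ‖x.2 - h • gradient V (x.1 + h • x.2) - (y.2 - h • gradient V (y.1 + h • y.2))‖
        = ‖(x.2 - y.2) - h • (gradient V (x.1 + h • x.2) - gradient V (y.1 + h • y.2))‖ := by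
          congr 1; rw [smul_sub]; abel
      _ ≤ ‖x.2 - y.2‖ + |h| * ‖gradient V (x.1 + h • x.2) - gradient V (y.1 + h • y.2)‖ := by
          simpa [norm_smul] using norm_sub_le (x.2 - y.2)
            (h • (gradient V (x.1 + h • x.2) - gradient V (y.1 + h • y.2)))
      _ ≤ _ := by
          gcongr
          exact (hK.norm_sub_le _ _).trans (by gcongr)
  refine norm_prod_le_iff.2 ⟨hq.trans ?_, hp.trans ?_⟩
  · gcongr
    nlinarith [mul_nonneg hK0 (abs_nonneg h)]
  · have hstep : |h| * (K * ((1 + |h|) * ‖x - y‖)) ≤ |h| * (K * ((1 + 1) * ‖x - y‖)) := by gcongr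
    nlinarith [mul_nonneg (abs_nonneg h) hn]

theorem norm_symplecticEuler_sub_taylor_le {V : ConfSpace m → ℝ} {K : ℝ≥0}
    (hK : LipschitzWith K (gradient V)) (h : ℝ) (x : PhaseSpace m) :
    ‖symplecticEuler V h x - x - h • hamiltonianField V x‖ ≤ (1 + 2 * K) * h ^ 2 * ‖x‖ := by
  have hK0 := K.coe_nonneg
  have hx : ‖x.2‖ ≤ ‖x‖ := norm_snd_le x
  have heq : symplecticEuler V h x - x - h • hamiltonianField V x
      = (0, -(h • (gradient V (x.1 + h • x.2) - gradient V x.1))) := by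
    refine Prod.ext ?_ ?_
    · simp [symplecticEuler, hamiltonianField]
    · simp only [symplecticEuler, hamiltonianField, Prod.snd_sub, Prod.smul_snd, smul_sub, smul_neg]
      abel
  rw [heq, Prod.norm_mk, norm_zero, norm_neg, norm_smul, max_eq_right (by positivity),
    Real.norm_eq_abs]
  have h1 : ‖gradient V (x.1 + h • x.2) - gradient V x.1‖ ≤ K * (|h| * ‖x‖) := by
    refine (hK.norm_sub_le _ _).trans ?_
    rw [add_sub_cancel_left, norm_smul, Real.norm_eq_abs]
    gcongr
  calc |h| * ‖gradient V (x.1 + h • x.2) - gradient V x.1‖ ≤ |h| * (K * (|h| * ‖x‖)) := by gcongr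
    _ = K * h ^ 2 * ‖x‖ := by rw [← sq_abs h]; ring
    _ ≤ (1 + 2 * K) * h ^ 2 * ‖x‖ := by gcongr; linarith

/-- A pointwise limit of measure preserving maps does not increase volume: for open `U`, the
indicator of `g ⁻¹' U` is at most the lower limit of the indicators of `f n ⁻¹' U`, and outer
regularity passes from open sets to all sets. -/
theorem map_le_of_tendsto_measurePreserving {X : Type*} [MeasurableSpace X] [TopologicalSpace X]
    [BorelSpace X] {μ : Measure X} [μ.OuterRegular] {f : ℕ → X → X} {g : X → X}
    (hf : ∀ n, MeasurePreserving (f n) μ μ) (hg : Measurable g)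
    (hlim : ∀ x, Tendsto (fun n => f n x) atTop (𝓝 (g x))) : μ.map g ≤ μ := by
  have hopen : ∀ U : Set X, IsOpen U → μ.map g U ≤ μ U := by
    intro U hU
    rw [Measure.map_apply hg hU.measurableSet]
    have hsub : g ⁻¹' U ⊆ ⋃ n, ⋂ k ≥ n, f k ⁻¹' U := by
      intro x hx
      obtain ⟨n, hn⟩ := eventually_atTop.1 ((hlim x).eventually (hU.mem_nhds hx))
      exact mem_iUnion.2 ⟨n, mem_iInter₂.2 hn⟩
    have hmono : Monotone fun n => ⋂ k ≥ n, f k ⁻¹' U := fun a b hab =>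
      biInter_subset_biInter_left fun k hk => le_trans hab hk
    calc μ (g ⁻¹' U) ≤ μ (⋃ n, ⋂ k ≥ n, f k ⁻¹' U) := measure_mono hsub
      _ = ⨆ n, μ (⋂ k ≥ n, f k ⁻¹' U) := hmono.measure_iUnion
      _ ≤ μ U := iSup_le fun n => (measure_mono (biInter_subset_of_mem (le_refl n))).trans
          ((hf n).measure_preimage hU.measurableSet.nullMeasurableSet).le
  refine Measure.le_iff.2 fun s _ => ?_
  rw [s.measure_eq_iInf_isOpen μ]
  exact le_iInf₂ fun U hU => le_iInf fun hUo => (measure_mono hU).trans (hopen U hUo)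

/-! ### The flow of a subquadratic surface and hopping trajectories -/

theorem IsSurfaceTrajectory.hasDerivAt_phase {V : ConfSpace m → ℝ} {γ : ℝ → FGAState m}
    (hγ : IsSurfaceTrajectory V γ) (s : ℝ) :
    HasDerivAt (fun s => ((γ s).1, (γ s).2.1))
      (hamiltonianField V ((γ s).1, (γ s).2.1)) s :=
  (hγ s).fst.prodMk (hγ s).snd.fst

theorem IsSurfaceTrajectory.hasDerivAt_action {V : ConfSpace m → ℝ} {γ : ℝ → FGAState m}
    (hγ : IsSurfaceTrajectory V γ) (s : ℝ) :
    HasDerivAt (fun s => (γ s).2.2) (‖(γ s).2.1‖ ^ 2 / 2 - V (γ s).1) s :=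
  (hγ s).snd.snd

theorem IsSubquadratic.exists_trajectory {V : ConfSpace m → ℝ} {C : ℝ}
    (hV : IsSubquadratic V C) (w : FGAState m) :
    ∃ γ : ℝ → FGAState m, γ 0 = w ∧ IsSurfaceTrajectory V γ := by
  obtain ⟨K, hK⟩ := hV.exists_lipschitzWith_gradient
  obtain ⟨γ, h0, hγ⟩ := exists_global_integralCurve (lipschitzWith_hamiltonianField hK)
    hV.contDiff_hamiltonianField (w.1, w.2.1)
  have hγc : Continuous γ := continuous_iff_continuousAt.2 fun s => (hγ s).continuousAt
  have hVc : Continuous V := hV.1.continuous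
  have hLc : Continuous fun s => ‖(γ s).2‖ ^ 2 / 2 - V (γ s).1 := by fun_prop
  refine ⟨fun s => ((γ s).1, (γ s).2, w.2.2 + ∫ σ in (0 : ℝ)..s, (‖(γ σ).2‖ ^ 2 / 2 - V (γ σ).1)),
    ?_, fun s => ?_⟩
  · simp [h0]
  · exact (hγ s).fst.prodMk ((hγ s).snd.prodMk
      ((intervalIntegral.integral_hasDerivAt_right (hLc.intervalIntegrable _ _)
        (hLc.stronglyMeasurableAtFilter _ _) hLc.continuousAt).const_add _))

/-- The phase space flow of a subquadratic surface together with the action accumulated along it: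
every trajectory is determined by its initial phase space point up to a constant shift of `S`. -/
theorem IsSubquadratic.exists_flow {V : ConfSpace m → ℝ} {C : ℝ} (hV : IsSubquadratic V C) :
    ∃ φ : ℝ → PhaseSpace m → PhaseSpace m,
      (∀ z, φ 0 z = z) ∧ (∀ z s, HasDerivAt (fun s => φ s z) (hamiltonianField V (φ s z)) s) ∧
      ∀ s w, surfaceFlow V s w = ((φ s (w.1, w.2.1)).1, (φ s (w.1, w.2.1)).2,
        w.2.2 + ∫ σ in (0 : ℝ)..s,
          (‖(φ σ (w.1, w.2.1)).2‖ ^ 2 / 2 - V (φ σ (w.1, w.2.1)).1)) := by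
  obtain ⟨K, hK⟩ := hV.exists_lipschitzWith_gradient
  choose φ h0 hφ using fun z : PhaseSpace m => exists_global_integralCurve
    (lipschitzWith_hamiltonianField hK) hV.contDiff_hamiltonianField z
  refine ⟨fun s z => φ z s, h0, hφ, fun s w => ?_⟩
  have hex := hV.exists_trajectory w
  have hVc : Continuous V := hV.1.continuous
  rw [surfaceFlow, dif_pos hex]
  obtain ⟨hγ0, hγ⟩ := hex.choose_spec
  set γ := hex.choose
  have hphase : (fun s => ((γ s).1, (γ s).2.1)) = φ (w.1, w.2.1) :=
    ODE_solution_unique_univ (v := fun _ => hamiltonianField V) (s := fun _ => univ) (t₀ := 0)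
      (fun _ => (lipschitzWith_hamiltonianField hK).lipschitzOnWith)
      (fun s => ⟨hγ.hasDerivAt_phase s, mem_univ _⟩) (fun s => ⟨hφ _ s, mem_univ _⟩)
      (by simp [hγ0, h0])
  have hq : ∀ s, (γ s).1 = (φ (w.1, w.2.1) s).1 := fun s => congrArg Prod.fst (congrFun hphase s)
  have hp : ∀ s, (γ s).2.1 = (φ (w.1, w.2.1) s).2 := fun s => congrArg Prod.snd (congrFun hphase s)
  have hφc : Continuous (φ (w.1, w.2.1)) :=
    continuous_iff_continuousAt.2 fun s => (hφ _ s).continuousAt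
  have hS : ∫ σ in (0 : ℝ)..s, (‖(φ (w.1, w.2.1) σ).2‖ ^ 2 / 2 - V (φ (w.1, w.2.1) σ).1)
      = (γ s).2.2 - w.2.2 := by
    have hLc : Continuous fun s => ‖(φ (w.1, w.2.1) s).2‖ ^ 2 / 2 - V (φ (w.1, w.2.1) s).1 := by
      fun_prop
    rw [intervalIntegral.integral_eq_sub_of_hasDerivAt (f := fun s => (γ s).2.2)
      (fun σ _ => by
        have := hγ.hasDerivAt_action σ
        rwa [hq, hp] at this) (hLc.intervalIntegrable _ _), hγ0]
  rw [hS]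
  exact Prod.ext (hq s) (Prod.ext (hp s) (by simp))

theorem tendsto_symplecticEuler_iterate {V : ConfSpace m → ℝ} {K : ℝ≥0}
    (hK : LipschitzWith K (gradient V)) {γ : ℝ → PhaseSpace m}
    (hγ : ∀ s, HasDerivAt γ (hamiltonianField V (γ s)) s) (t : ℝ) :
    Tendsto (fun n : ℕ => (symplecticEuler V (t / n))^[n] (γ 0)) atTop (𝓝 (γ t)) :=
  tendsto_iterate_of_oneStep (lipschitzWith_hamiltonianField hK) (K := 1 + 2 * K) (by positivity)
    (fun _ x y hh => norm_symplecticEuler_sub_le hK hh x y)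
    (norm_symplecticEuler_sub_taylor_le hK) hγ t

/-- A map of states which acts on phase space by a measurable map that does not increase volume,
and which shifts the action by a measurable function of the phase space point. -/
def IsVolumeContracting (F : FGAState m → FGAState m) : Prop :=
  ∃ (κ : PhaseSpace m → PhaseSpace m) (σ : PhaseSpace m → ℝ), Measurable κ ∧ Measurable σ ∧
    Measure.map κ volume ≤ volume ∧
    ∀ w, F w = ((κ (w.1, w.2.1)).1, (κ (w.1, w.2.1)).2, w.2.2 + σ (w.1, w.2.1))

theorem IsVolumeContracting.comp {F G : FGAState m → FGAState m} (hF : IsVolumeContracting F)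
    (hG : IsVolumeContracting G) : IsVolumeContracting (F ∘ G) := by
  obtain ⟨κ, σ, hκ, hσ, hle, h⟩ := hF
  obtain ⟨κ', σ', hκ', hσ', hle', h'⟩ := hG
  refine ⟨κ ∘ κ', fun z => σ' z + σ (κ' z), hκ.comp hκ', hσ'.add (hσ.comp hκ'), ?_, fun w => ?_⟩
  · rw [← Measure.map_map hκ hκ']
    exact (Measure.map_mono hle' hκ).trans hle
  · simp [h, h', add_assoc]

/-- Liouville's theorem for a subquadratic surface, as an inequality, with measurable dependence of
the action on the initial point. Flow and volume bound come from the symplectic Euler scheme; the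
action is an integral along the flow. -/
theorem IsSubquadratic.isVolumeContracting_surfaceFlow {V : ConfSpace m → ℝ} {C : ℝ}
    (hV : IsSubquadratic V C) (t : ℝ) : IsVolumeContracting (surfaceFlow V t) := by
  obtain ⟨K, hK⟩ := hV.exists_lipschitzWith_gradient
  obtain ⟨φ, h0, hφ, hflow⟩ := hV.exists_flow
  have hVc : Continuous V := hV.1.continuous
  have hlim : ∀ t z, Tendsto (fun n : ℕ => (symplecticEuler V (t / n))^[n] z) atTop (𝓝 (φ t z)) := by
    intro t z
    have := tendsto_symplecticEuler_iterate hK (hφ z) t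
    rwa [h0] at this
  have hmp : ∀ (t : ℝ) (n : ℕ), MeasurePreserving ((symplecticEuler V (t / n))^[n]) :=
    fun t n => (measurePreserving_symplecticEuler hK.continuous _).iterate n
  have hmeas : ∀ t, Measurable (φ t) := fun t =>
    measurable_of_tendsto_metrizable (fun n => (hmp t n).measurable)
      (tendsto_pi_nhds.2 fun z => hlim t z)
  have hcont : ∀ z, Continuous fun s => φ s z :=
    fun z => continuous_iff_continuousAt.2 fun s => (hφ z s).continuousAt
  have hjoint : Measurable (Function.uncurry φ) :=
    measurable_uncurry_of_continuous_of_measurable (u := φ) hcont hmeas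
  have hL : Measurable fun x : PhaseSpace m × ℝ => ‖(φ x.2 x.1).2‖ ^ 2 / 2 - V (φ x.2 x.1).1 := by
    have hφ' : Measurable fun x : PhaseSpace m × ℝ => φ x.2 x.1 := hjoint.comp measurable_swap
    exact ((hφ'.snd.norm.pow_const 2).div_const 2).sub (hVc.measurable.comp hφ'.fst)
  refine ⟨φ t, fun z => ∫ σ in (0 : ℝ)..t, (‖(φ σ z).2‖ ^ 2 / 2 - V (φ σ z).1), hmeas t, ?_,
    map_le_of_tendsto_measurePreserving (hmp t) (hmeas t) (hlim t), hflow t⟩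
  simp only [intervalIntegral]
  exact (hL.stronglyMeasurable.integral_prod_right' (ν := volume.restrict (Ioc 0 t))).measurable.sub
    (hL.stronglyMeasurable.integral_prod_right' (ν := volume.restrict (Ioc t 0))).measurable

/-- Hopping composes single-surface flows; a hop changes neither `(Q, P)` nor `S`. -/
theorem isVolumeContracting_hopState {E : Fin 2 → ConfSpace m → ℝ} {C : ℝ}
    (hE : ∀ k, IsSubquadratic (E k) C) (t : ℝ) (T : List ℝ) (l : Fin 2) (a : ℝ) :
    IsVolumeContracting (hopState E t T l a) := by
  induction T generalizing l a with
  | nil => exact (hE l).isVolumeContracting_surfaceFlow (t - a)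
  | cons t₁ ts ih =>
    by_cases h : t ≤ t₁
    · have : hopState E t (t₁ :: ts) l a = surfaceFlow (E l) (t - a) := by
        funext w; simp [hopState, h]
      rw [this]
      exact (hE l).isVolumeContracting_surfaceFlow (t - a)
    · have : hopState E t (t₁ :: ts) l a
          = hopState E t ts (l + 1) t₁ ∘ surfaceFlow (E l) (t₁ - a) := by
        funext w; simp [hopState, h]
      rw [this]
      exact (ih (l + 1) t₁).comp ((hE l).isVolumeContracting_surfaceFlow (t₁ - a))

theorem fgaMap_measurable_and_map_le {E : Fin 2 → ConfSpace m → ℝ} {C : ℝ}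
    (hE : ∀ k, IsSubquadratic (E k) C) (i : Fin 2) (t : ℝ) (T : List ℝ) :
    Measurable (fgaMap E i t T) ∧ Measurable (fgaAction E i t T) ∧
      Measure.map (fgaMap E i t T) volume ≤ volume := by
  obtain ⟨κ, σ, hκ, hσ, hle, h⟩ := isVolumeContracting_hopState hE t T i 0
  have h1 : fgaMap E i t T = κ := by funext z; simp [fgaMap, fgaVars, h]
  have h2 : fgaAction E i t T = σ := by funext z; simp [fgaAction, fgaVars, h]
  rw [h1, h2]
  exact ⟨hκ, hσ, hle⟩

end Flow

/-! ### Coherent states and the FBI transform -/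

section CoherentState

open Filter Topology Set
open scoped NNReal ComplexConjugate FourierTransform LineDeriv

variable {m : ℕ}

/-- The coherent state `exp((i/ε)((i/2)|y - q|² + p·(y - q)))` centred at `z = (q, p)`. -/
noncomputable def coherentState (ε : ℝ) (z : PhaseSpace m) (y : ConfSpace m) : ℂ :=
  Complex.exp (Complex.I / (ε : ℂ) * (Complex.I / 2 * ((‖y - z.1‖ ^ 2 : ℝ) : ℂ)
    + ((inner ℝ z.2 (y - z.1) : ℝ) : ℂ)))

/-- The (unnormalised) FBI transform: the pairing of `u` with the coherent state at `z`. -/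
noncomputable def fbiTransform (ε : ℝ) (u : ConfSpace m → ℂ) (z : PhaseSpace m) : ℂ :=
  ∫ y, conj (coherentState ε z y) * u y

theorem coherentState_eq_mul (ε : ℝ) (z : PhaseSpace m) (y : ConfSpace m) :
    coherentState ε z y = (Real.exp (-(2 * ε)⁻¹ * ‖y - z.1‖ ^ 2) : ℂ)
      * Complex.exp ((inner ℝ z.2 (y - z.1) / ε : ℝ) * Complex.I) := by
  rw [coherentState, Complex.ofReal_exp, ← Complex.exp_add]
  congr 1
  push_cast
  rw [mul_add, ← mul_assoc, div_mul_div_comm, Complex.I_mul_I, mul_inv, div_eq_mul_inv]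
  ring

theorem conj_coherentState (ε : ℝ) (z : PhaseSpace m) (y : ConfSpace m) :
    conj (coherentState ε z y) = (Real.exp (-(2 * ε)⁻¹ * ‖y - z.1‖ ^ 2) : ℂ)
      * Complex.exp ((-(inner ℝ z.2 (y - z.1)) / ε : ℝ) * Complex.I) := by
  rw [coherentState_eq_mul, map_mul, Complex.conj_ofReal, ← Complex.exp_conj, map_mul,
    Complex.conj_I, Complex.conj_ofReal]
  congr 2
  push_cast
  ring

theorem norm_coherentState (ε : ℝ) (z : PhaseSpace m) (y : ConfSpace m) :
    ‖coherentState ε z y‖ = Real.exp (-(2 * ε)⁻¹ * ‖y - z.1‖ ^ 2) := by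
  rw [coherentState_eq_mul, norm_mul, Complex.norm_exp_ofReal_mul_I, mul_one, Complex.norm_real,
    Real.norm_eq_abs, Real.abs_exp]

theorem norm_coherentState_le_one {ε : ℝ} (hε : 0 < ε) (z : PhaseSpace m) (y : ConfSpace m) :
    ‖coherentState ε z y‖ ≤ 1 := by
  rw [norm_coherentState, Real.exp_le_one_iff, neg_mul, neg_nonpos]
  positivity

theorem continuous_coherentState (ε : ℝ) :
    Continuous fun x : PhaseSpace m × ConfSpace m => coherentState ε x.1 x.2 := by
  unfold coherentState
  fun_prop

theorem continuous_coherentState_right (ε : ℝ) (z : PhaseSpace m) :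
    Continuous (coherentState ε z) := by
  unfold coherentState
  fun_prop

theorem integrable_conj_coherentState_mul {ε : ℝ} (hε : 0 < ε) {u : ConfSpace m → ℂ}
    (hu : Integrable u) (z : PhaseSpace m) :
    Integrable fun y => conj (coherentState ε z y) * u y :=
  hu.bdd_mul (c := 1)
    (Complex.continuous_conj.comp (continuous_coherentState_right ε z)).aestronglyMeasurable
    (Eventually.of_forall fun y => by
      simpa using norm_coherentState_le_one hε z y)

theorem norm_fbiTransform_le {ε : ℝ} (hε : 0 < ε) {u : ConfSpace m → ℂ} (hu : Integrable u)
    (z : PhaseSpace m) : ‖fbiTransform ε u z‖ ≤ ∫ y, ‖u y‖ :=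
  norm_integral_le_of_norm_le hu.norm (Eventually.of_forall fun y => by
    rw [norm_mul, RCLike.norm_conj]
    exact mul_le_of_le_one_left (norm_nonneg _) (norm_coherentState_le_one hε z y))

theorem continuous_fbiTransform {ε : ℝ} (hε : 0 < ε) {u : ConfSpace m → ℂ} (hu : Integrable u) :
    Continuous (fbiTransform ε u) :=
  continuous_of_dominated (bound := fun y => ‖u y‖)
    (fun z => (integrable_conj_coherentState_mul hε hu z).aestronglyMeasurable)
    (fun z => Eventually.of_forall fun y => by
      rw [norm_mul, RCLike.norm_conj]
      exact mul_le_of_le_one_left (norm_nonneg _) (norm_coherentState_le_one hε z y))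
    hu.norm
    (Eventually.of_forall fun y => by
      unfold coherentState
      fun_prop)

theorem fbiTransform_add {ε : ℝ} (hε : 0 < ε) {u v : ConfSpace m → ℂ} (hu : Integrable u)
    (hv : Integrable v) (z : PhaseSpace m) :
    fbiTransform ε (fun y => u y + v y) z = fbiTransform ε u z + fbiTransform ε v z := by
  simp only [fbiTransform, mul_add]
  exact integral_add (integrable_conj_coherentState_mul hε hu z)
    (integrable_conj_coherentState_mul hε hv z)

theorem fbiTransform_const_mul (ε : ℝ) (c : ℂ) (u : ConfSpace m → ℂ) (z : PhaseSpace m) :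
    fbiTransform ε (fun y => c * u y) z = c * fbiTransform ε u z := by
  simp only [fbiTransform, mul_left_comm _ c]
  exact integral_const_mul _ _

/-! ### Rapid decay of the FBI transform -/

theorem fderiv_conj_coherentState (ε : ℝ) (z : PhaseSpace m) (y : ConfSpace m) :
    DifferentiableAt ℝ (fun y => conj (coherentState ε z y)) y ∧ ∀ a,
    fderiv ℝ (fun y => conj (coherentState ε z y)) y (unitVec a)
      = -(ε : ℂ)⁻¹ * ((y a : ℂ) - ((z.1 a : ℂ) - Complex.I * (z.2 a : ℂ)))
        * conj (coherentState ε z y) := by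
  have h1 : HasFDerivAt (fun y : ConfSpace m => y - z.1) (ContinuousLinearMap.id ℝ _) y :=
    (hasFDerivAt_id y).sub_const z.1
  have h2 := h1.norm_sq
  have h3 := ((innerSL ℝ z.2).hasFDerivAt (x := y - z.1)).comp y h1
  have e1 := ((Complex.ofRealCLM.hasFDerivAt.comp y (h2.const_mul (-(2 * ε)⁻¹))).add
      ((h3.const_mul (-ε⁻¹)).smul_const Complex.I)).cexp
  have h4 := e1.congr_of_eventuallyEq (f₁ := fun y => conj (coherentState ε z y))
      (Eventually.of_forall fun y => by
    beta_reduce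
    rw [conj_coherentState, Complex.ofReal_exp, ← Complex.exp_add]
    congr 1
    simp
    ring)
  refine ⟨h4.differentiableAt, fun a => ?_⟩
  rw [h4.fderiv, conj_coherentState, Complex.ofReal_exp, ← Complex.exp_add]
  simp [unitVec, EuclideanSpace.inner_single_right]
  field_simp
  ring_nf

/-- The FBI transform intertwines multiplication by the complex coordinate `qₐ - i pₐ` with the
operator `yₐ - ε ∂ₐ`, which preserves the Schwartz space; this is integration by parts. -/
theorem exists_mul_fbiTransform_eq {ε : ℝ} (hε : 0 < ε) (u : 𝓢(ConfSpace m, ℂ)) (a : Fin m) :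
    ∃ w : 𝓢(ConfSpace m, ℂ), ∀ z : PhaseSpace m,
      ((z.1 a : ℂ) - Complex.I * (z.2 a : ℂ)) * fbiTransform ε u z = fbiTransform ε w z := by
  have hcoord : (fun y : ConfSpace m => (y a : ℂ)).HasTemperateGrowth :=
    (Complex.ofRealCLM.comp (EuclideanSpace.proj a : ConfSpace m →L[ℝ] ℝ)).hasTemperateGrowth
  set yu : 𝓢(ConfSpace m, ℂ) := SchwartzMap.smulLeftCLM ℂ (fun y : ConfSpace m => (y a : ℂ)) u
    with hyu
  have hyu' : ∀ y, yu y = (y a : ℂ) * u y := fun y => by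
    rw [hyu, SchwartzMap.smulLeftCLM_apply_apply hcoord, smul_eq_mul]
  set du : 𝓢(ConfSpace m, ℂ) := ∂_{(unitVec a : ConfSpace m)} u with hdu
  have hdu' : ∀ y, du y = fderiv ℝ u y (unitVec a) := fun y =>
    SchwartzMap.lineDerivOp_apply_eq_fderiv _ _ _
  refine ⟨yu - (ε : ℂ) • du, fun z => ?_⟩
  have iu := integrable_conj_coherentState_mul hε u.integrable z
  have iyu := integrable_conj_coherentState_mul hε yu.integrable z
  have idu := integrable_conj_coherentState_mul hε du.integrable z
  set ζ : ℂ := (z.1 a : ℂ) - Complex.I * (z.2 a : ℂ) with hζ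
  have hε' : (ε : ℂ) ≠ 0 := by exact_mod_cast hε.ne'
  have hder : ∀ y, fderiv ℝ (fun y => conj (coherentState ε z y)) y (unitVec a) * u y
      = -(ε : ℂ)⁻¹ * (conj (coherentState ε z y) * yu y)
        + (ε : ℂ)⁻¹ * ζ * (conj (coherentState ε z y) * u y) := fun y => by
    rw [(fderiv_conj_coherentState ε z y).2, hyu']; ring
  have hparts := integral_mul_fderiv_eq_neg_fderiv_mul_of_integrable (μ := volume)
    (f := fun y => conj (coherentState ε z y)) (g := u) (v := unitVec a)
    (by
      simp only [hder]
      exact (iyu.const_mul _).add (iu.const_mul _))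
    (by simpa only [hdu'] using idu) iu
    (fun y _ => (fderiv_conj_coherentState ε z y).1) (fun y _ => u.differentiableAt)
  simp only [hder, ← hdu'] at hparts
  rw [integral_add (iyu.const_mul _) (iu.const_mul _), integral_const_mul, integral_const_mul]
    at hparts
  have hw : fbiTransform ε (yu - (ε : ℂ) • du) z
      = fbiTransform ε yu z - ε * fbiTransform ε du z := by
    simp only [fbiTransform]
    rw [← integral_const_mul, ← integral_sub iyu (idu.const_mul _)]
    refine integral_congr_ae (Eventually.of_forall fun y => ?_)
    simp
    ring
  have hparts' : fbiTransform ε du z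
      = -(-(ε : ℂ)⁻¹ * fbiTransform ε yu z + (ε : ℂ)⁻¹ * ζ * fbiTransform ε u z) := hparts
  have hcoe : fbiTransform ε (⇑(yu - (ε : ℂ) • du)) z = fbiTransform ε (yu - (ε : ℂ) • du) z := rfl
  rw [hcoe, hw, hparts']
  field_simp
  ring

theorem norm_le_sum_abs (x : ConfSpace m) : ‖x‖ ≤ ∑ a, |x a| := by
  have h := (EuclideanSpace.basisFun (Fin m) ℝ).sum_repr x
  calc ‖x‖ = ‖∑ a, x a • (unitVec a : ConfSpace m)‖ := by
        congr 1; simpa [unitVec, EuclideanSpace.basisFun_apply] using h.symm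
    _ ≤ ∑ a, |x a| := (norm_sum_le _ _).trans (le_of_eq (by simp [norm_smul, unitVec]))

theorem norm_le_sum_norm_complex (z : PhaseSpace m) :
    ‖z‖ ≤ ∑ a, ‖(z.1 a : ℂ) - Complex.I * (z.2 a : ℂ)‖ := by
  refine norm_prod_le_iff.2 ⟨(norm_le_sum_abs z.1).trans (Finset.sum_le_sum fun a _ => ?_),
    (norm_le_sum_abs z.2).trans (Finset.sum_le_sum fun a _ => ?_)⟩
  · simpa using Complex.abs_re_le_norm ((z.1 a : ℂ) - Complex.I * (z.2 a : ℂ))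
  · simpa using Complex.abs_im_le_norm ((z.1 a : ℂ) - Complex.I * (z.2 a : ℂ))

/-- The FBI transform of a Schwartz function decays faster than any power of `z`. -/
theorem exists_pow_mul_norm_fbiTransform_le {ε : ℝ} (hε : 0 < ε) (k : ℕ)
    (u : 𝓢(ConfSpace m, ℂ)) : ∃ C, ∀ z : PhaseSpace m, ‖z‖ ^ k * ‖fbiTransform ε u z‖ ≤ C := by
  induction k generalizing u with
  | zero => exact ⟨_, fun z => by simpa using norm_fbiTransform_le hε u.integrable z⟩
  | succ k ih =>
    choose w hw using exists_mul_fbiTransform_eq hε u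
    choose C hC using fun a => ih (w a)
    refine ⟨∑ a, C a, fun z => ?_⟩
    calc ‖z‖ ^ (k + 1) * ‖fbiTransform ε u z‖
        = ‖z‖ ^ k * (‖z‖ * ‖fbiTransform ε u z‖) := by ring
      _ ≤ ‖z‖ ^ k * ((∑ a, ‖(z.1 a : ℂ) - Complex.I * (z.2 a : ℂ)‖) * ‖fbiTransform ε u z‖) := by
          gcongr; exact norm_le_sum_norm_complex z
      _ = ∑ a, ‖z‖ ^ k * ‖fbiTransform ε (w a) z‖ := by
          rw [Finset.sum_mul, Finset.mul_sum]
          refine Finset.sum_congr rfl fun a _ => ?_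
          rw [← hw a z, norm_mul]
      _ ≤ ∑ a, C a := Finset.sum_le_sum fun a _ => hC a z

/-- Typeclass inference does not see through `volume` on the product to the product measure. -/
theorem isAddHaarMeasure_volume_phaseSpace :
    (volume : Measure (PhaseSpace m)).IsAddHaarMeasure :=
  inferInstanceAs ((volume : Measure (ConfSpace m)).prod
    (volume : Measure (ConfSpace m))).IsAddHaarMeasure

theorem integrable_fbiTransform {ε : ℝ} (hε : 0 < ε) (u : 𝓢(ConfSpace m, ℂ)) :
    Integrable (fbiTransform ε u) (volume : Measure (PhaseSpace m)) := by
  have := isAddHaarMeasure_volume_phaseSpace (m := m)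
  have hmeas := (continuous_fbiTransform hε u.integrable).aestronglyMeasurable
    (μ := (volume : Measure (PhaseSpace m)))
  obtain ⟨C, hC⟩ := exists_pow_mul_norm_fbiTransform_le hε
    (0 + (volume : Measure (PhaseSpace m)).integrablePower) u
  have := integrable_of_le_of_pow_mul_le (k := 0) (norm_fbiTransform_le hε u.integrable) hC hmeas
  rw [← integrable_norm_iff hmeas]
  simpa using this

theorem integrable_norm_sq_fbiTransform {ε : ℝ} (hε : 0 < ε) (u : 𝓢(ConfSpace m, ℂ)) :
    Integrable (fun z => ‖fbiTransform ε u z‖ ^ 2) (volume : Measure (PhaseSpace m)) := by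
  have h := (integrable_fbiTransform hε u).norm
  simp only [sq]
  exact h.bdd_mul h.aestronglyMeasurable (Eventually.of_forall fun z => by
    simpa using norm_fbiTransform_le hε u.integrable z)

theorem memLp_two_fbiTransform {ε : ℝ} (hε : 0 < ε) (u : 𝓢(ConfSpace m, ℂ)) :
    MemLp (fbiTransform ε u) 2 (volume : Measure (PhaseSpace m)) :=
  (memLp_two_iff_integrable_sq_norm (integrable_fbiTransform hε u).aestronglyMeasurable).2
    (integrable_norm_sq_fbiTransform hε u)

/-! ### Plancherel identity for the FBI transform -/

theorem hasTemperateGrowth_exp_neg_mul {c : ℝ} (hc : 0 ≤ c) (q : ConfSpace m) :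
    (fun y : ConfSpace m => (Real.exp (-c * ‖y - q‖ ^ 2) : ℂ)).HasTemperateGrowth := by
  have h1 : (fun y : ConfSpace m => y - q).HasTemperateGrowth := by fun_prop
  have h2 : (fun y : ConfSpace m => ‖y - q‖ ^ 2).HasTemperateGrowth :=
    (Function.hasTemperateGrowth_norm_sq (H := ConfSpace m)).comp h1
  have h3 : ((fun s : ℝ => Real.exp (-c * s)) ∘ fun y : ConfSpace m =>
      ‖y - q‖ ^ 2).HasTemperateGrowth := by
    refine Function.HasTemperateGrowth.comp' (t := Ici 0) ?_ (uniqueDiffOn_Ici 0) ?_ ?_ h2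
    · rintro _ ⟨y, rfl⟩
      exact sq_nonneg ‖y - q‖
    · exact (Real.contDiff_exp.comp (contDiff_const.mul contDiff_id)).contDiffOn
    · intro N
      refine ⟨0, ∑ n ∈ Finset.range (N + 1), c ^ n, by positivity, fun n hn s hs => ?_⟩
      have hcd : ContDiff ℝ n fun s : ℝ => Real.exp (-c * s) :=
        Real.contDiff_exp.comp (contDiff_const.mul contDiff_id)
      rw [iteratedFDerivWithin_eq_iteratedFDeriv (uniqueDiffOn_Ici 0) hcd.contDiffAt hs,
        norm_iteratedFDeriv_eq_norm_iteratedDeriv, iteratedDeriv_exp_const_mul]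
      have hs' : Real.exp (-c * s) ≤ 1 := by
        rw [Real.exp_le_one_iff, neg_mul, neg_nonpos]
        exact mul_nonneg hc hs
      rw [norm_mul, norm_pow, norm_neg, Real.norm_eq_abs, Real.norm_eq_abs, Real.abs_exp,
        abs_of_nonneg hc, pow_zero, mul_one]
      calc c ^ n * Real.exp (-c * s) ≤ c ^ n * 1 := by gcongr
        _ ≤ ∑ n ∈ Finset.range (N + 1), c ^ n := by
          rw [mul_one]
          exact Finset.single_le_sum (f := fun n => c ^ n) (fun _ _ => by positivity)
            (Finset.mem_range.2 (by omega))
  exact Function.Complex.hasTemperateGrowth_ofReal.comp h3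

/-- Plancherel in the momentum variable: for fixed `q`, the FBI transform is up to a phase the
Fourier transform of `y ↦ exp(-|y - q|²/(2ε)) u(y)` at `p / (2πε)`. -/
theorem integral_norm_sq_fbiTransform_momentum {ε : ℝ} (hε : 0 < ε) (u : 𝓢(ConfSpace m, ℂ))
    (q : ConfSpace m) : ∫ p, ‖fbiTransform ε u (q, p)‖ ^ 2
      = (2 * Real.pi * ε) ^ m * ∫ y, Real.exp (-ε⁻¹ * ‖y - q‖ ^ 2) * ‖u y‖ ^ 2 := by
  have hg := hasTemperateGrowth_exp_neg_mul (c := (2 * ε)⁻¹) (by positivity) q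
  set f : 𝓢(ConfSpace m, ℂ) := SchwartzMap.smulLeftCLM ℂ
    (fun y : ConfSpace m => (Real.exp (-(2 * ε)⁻¹ * ‖y - q‖ ^ 2) : ℂ)) u with hf
  have hf' : ∀ y, f y = (Real.exp (-(2 * ε)⁻¹ * ‖y - q‖ ^ 2) : ℂ) * u y := fun y => by
    rw [hf, SchwartzMap.smulLeftCLM_apply_apply hg, smul_eq_mul]
  have hW : ∀ p, ‖fbiTransform ε u (q, p)‖ ^ 2 = ‖𝓕 f ((2 * Real.pi * ε)⁻¹ • p)‖ ^ 2 := by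
    intro p
    have : fbiTransform ε u (q, p) = Complex.exp ((inner ℝ p q / ε : ℝ) * Complex.I)
        * 𝓕 f ((2 * Real.pi * ε)⁻¹ • p) := by
      rw [SchwartzMap.fourier_coe, Real.fourier_eq', fbiTransform, ← integral_const_mul]
      refine integral_congr_ae (Eventually.of_forall fun y => ?_)
      simp only [conj_coherentState, hf', smul_eq_mul]
      have hexp : Complex.exp ((-(inner ℝ p (y - q)) / ε : ℝ) * Complex.I)
          = Complex.exp ((inner ℝ p q / ε : ℝ) * Complex.I) * Complex.exp
            ((-2 * Real.pi * inner ℝ y ((2 * Real.pi * ε)⁻¹ • p) : ℝ) * Complex.I) := by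
        rw [← Complex.exp_add, ← add_mul, ← Complex.ofReal_add, inner_sub_right,
          real_inner_smul_right, real_inner_comm y p]
        congr 3
        field_simp
        ring
      rw [hexp]
      ring
    rw [this, norm_mul, Complex.norm_exp_ofReal_mul_I, one_mul]
  simp only [hW]
  rw [Measure.integral_comp_smul volume (fun w => ‖𝓕 f w‖ ^ 2), SchwartzMap.integral_norm_sq_fourier,
    finrank_euclideanSpace_fin, smul_eq_mul, inv_pow, inv_inv, abs_of_pos (by positivity)]
  congr 1
  refine integral_congr_ae (Eventually.of_forall fun y => ?_)
  simp only [hf']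
  rw [norm_mul, mul_pow, Complex.norm_real, Real.norm_eq_abs, Real.abs_exp, ← Real.exp_nat_mul]
  congr 2
  push_cast
  rw [mul_inv]
  ring

/-- The FBI transform is a multiple of an isometry on `L²`. -/
theorem integral_norm_sq_fbiTransform {ε : ℝ} (hε : 0 < ε) (u : 𝓢(ConfSpace m, ℂ)) :
    ∫ z : PhaseSpace m, ‖fbiTransform ε u z‖ ^ 2
      = (2 * Real.pi * ε) ^ m * (Real.pi * ε) ^ ((m : ℝ) / 2) * ∫ y, ‖u y‖ ^ 2 := by
  have hgauss : ∀ y : ConfSpace m, ∫ q, Real.exp (-ε⁻¹ * ‖y - q‖ ^ 2) * ‖u y‖ ^ 2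
      = (Real.pi * ε) ^ ((m : ℝ) / 2) * ‖u y‖ ^ 2 := by
    intro y
    rw [integral_mul_const, integral_sub_left_eq_self (fun q => Real.exp (-ε⁻¹ * ‖q‖ ^ 2)) volume y,
      GaussianFourier.integral_rexp_neg_mul_sq_norm (by positivity), finrank_euclideanSpace_fin,
      div_inv_eq_mul]
  have hgint : Integrable fun q : ConfSpace m => Real.exp (-ε⁻¹ * ‖q‖ ^ 2) := by
    -- a nonintegrable function would have integral zero, but the Gaussian integral is positive
    by_contra h
    have h1 := GaussianFourier.integral_rexp_neg_mul_sq_norm (V := ConfSpace m)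
      (b := ε⁻¹) (by positivity)
    rw [integral_undef h] at h1
    have : 0 < (Real.pi / ε⁻¹) ^ ((Module.finrank ℝ (ConfSpace m) : ℝ) / 2) := by positivity
    exact this.ne h1
  have husq : Integrable fun y => ‖u y‖ ^ 2 :=
    (memLp_two_iff_integrable_sq_norm u.continuous.aestronglyMeasurable).1 (u.memLp 2 volume)
  have hprod : Integrable (Function.uncurry fun q y : ConfSpace m =>
      Real.exp (-ε⁻¹ * ‖y - q‖ ^ 2) * ‖u y‖ ^ 2) (volume.prod volume) := by
    rw [integrable_prod_iff' (by
      have := u.continuous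
      exact Continuous.aestronglyMeasurable (by fun_prop))]
    refine ⟨Eventually.of_forall fun y => ?_, ?_⟩
    · exact (hgint.comp_sub_left y).mul_const (‖u y‖ ^ 2)
    · have : ∀ y q : ConfSpace m, ‖Function.uncurry (fun q y : ConfSpace m =>
          Real.exp (-ε⁻¹ * ‖y - q‖ ^ 2) * ‖u y‖ ^ 2) (q, y)‖
          = Real.exp (-ε⁻¹ * ‖y - q‖ ^ 2) * ‖u y‖ ^ 2 := fun y q =>
        Real.norm_of_nonneg (by simp only [Function.uncurry]; positivity)
      simp only [this, hgauss]
      exact husq.const_mul _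
  have hsq := integrable_norm_sq_fbiTransform hε u
  rw [Measure.volume_eq_prod] at hsq ⊢
  rw [integral_prod _ hsq]
  simp only [integral_norm_sq_fbiTransform_momentum hε]
  rw [integral_const_mul, integral_integral_swap hprod]
  simp only [hgauss]
  rw [integral_const_mul]
  ring

/-! ### Operators on `L²` built from the FBI transform -/

/-- The factor by which the FBI transform multiplies squared `L²` norms. -/
noncomputable def fbiNormSq (m : ℕ) (ε : ℝ) : ℝ :=
  (2 * Real.pi * ε) ^ m * (Real.pi * ε) ^ ((m : ℝ) / 2)

theorem fbiNormSq_nonneg (m : ℕ) {ε : ℝ} (hε : 0 < ε) : 0 ≤ fbiNormSq m ε := by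
  unfold fbiNormSq; positivity

theorem rpow_mul_fbiNormSq (m : ℕ) {ε : ℝ} (hε : 0 < ε) :
    (2 * Real.pi * ε) ^ (-(3 * (m : ℝ) / 2)) * fbiNormSq m ε = 2 ^ (-((m : ℝ) / 2)) := by
  have hpi := Real.pi_pos
  rw [fbiNormSq, ← mul_assoc, ← Real.rpow_natCast, ← Real.rpow_add (by positivity),
    show -(3 * (m : ℝ) / 2) + m = -((m : ℝ) / 2) by ring, mul_assoc 2,
    Real.mul_rpow (by norm_num) (by positivity), mul_assoc, ← Real.rpow_add (by positivity)]
  simp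

theorem eLpNorm_two_fbiTransform {ε : ℝ} (hε : 0 < ε) (u : 𝓢(ConfSpace m, ℂ)) :
    eLpNorm (fbiTransform ε u) 2 (volume : Measure (PhaseSpace m))
      = ENNReal.ofReal (√(fbiNormSq m ε)) * eLpNorm u 2 (volume : Measure (ConfSpace m)) := by
  rw [(memLp_two_fbiTransform hε u).eLpNorm_eq_integral_rpow_norm two_ne_zero ENNReal.ofNat_ne_top,
    (u.memLp 2 volume).eLpNorm_eq_integral_rpow_norm two_ne_zero ENNReal.ofNat_ne_top,
    ← ENNReal.ofReal_mul (Real.sqrt_nonneg _)]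
  simp only [ENNReal.toReal_ofNat, Real.rpow_ofNat]
  rw [integral_norm_sq_fbiTransform hε u, Real.sqrt_eq_rpow, ← one_div,
    ← Real.mul_rpow (fbiNormSq_nonneg m hε) (integral_nonneg fun _ => by positivity), fbiNormSq]

/-- Composing with a map that does not increase volume, and multiplying by a bounded function, does
not spoil the `L²` bound of the FBI transform. -/
theorem memLp_mul_fbiTransform_comp {ε : ℝ} (hε : 0 < ε) {φ : PhaseSpace m → ℂ}
    {κ : PhaseSpace m → PhaseSpace m} {K : ℝ} (hφ : AEStronglyMeasurable φ volume)
    (hK : ∀ᵐ z, ‖φ z‖ ≤ K) (hκ : Measurable κ) (hle : Measure.map κ volume ≤ volume)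
    (u : 𝓢(ConfSpace m, ℂ)) :
    MemLp (fun z => φ z * fbiTransform ε u (κ z)) 2 volume ∧
    eLpNorm (fun z => φ z * fbiTransform ε u (κ z)) 2 volume
      ≤ ENNReal.ofReal (K * √(fbiNormSq m ε)) * eLpNorm u 2 volume := by
  have hc := continuous_fbiTransform hε u.integrable
  have hmeas : AEStronglyMeasurable (fun z => φ z * fbiTransform ε u (κ z)) volume :=
    hφ.mul (hc.measurable.comp hκ).aestronglyMeasurable
  have hbound : eLpNorm (fun z => φ z * fbiTransform ε u (κ z)) 2 volume
      ≤ ENNReal.ofReal (K * √(fbiNormSq m ε)) * eLpNorm u 2 volume := by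
    calc eLpNorm (fun z => φ z * fbiTransform ε u (κ z)) 2 volume
        ≤ ENNReal.ofReal K * eLpNorm (fbiTransform ε u ∘ κ) 2 volume := by
          refine eLpNorm_le_mul_eLpNorm_of_ae_le_mul ?_ 2
          filter_upwards [hK] with z hz
          rw [norm_mul]
          exact mul_le_mul_of_nonneg_right hz (norm_nonneg _)
      _ = ENNReal.ofReal K * eLpNorm (fbiTransform ε u) 2 (Measure.map κ volume) := by
          rw [eLpNorm_map_measure hc.aestronglyMeasurable hκ.aemeasurable]
      _ ≤ ENNReal.ofReal K * eLpNorm (fbiTransform ε u) 2 volume := by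
          gcongr
      _ = _ := by
          rw [eLpNorm_two_fbiTransform hε, ← mul_assoc, ENNReal.ofReal_mul' (Real.sqrt_nonneg _)]
  exact ⟨⟨hmeas, hbound.trans_lt
    (ENNReal.mul_lt_top ENNReal.ofReal_lt_top (u.memLp 2 volume).eLpNorm_lt_top)⟩, hbound⟩

/-- The extension of `u ↦ φ · (fbiTransform u) ∘ κ` from Schwartz functions to `L²`. -/
theorem exists_clm_mul_fbiTransform_comp {ε : ℝ} (hε : 0 < ε) {φ : PhaseSpace m → ℂ}
    {κ : PhaseSpace m → PhaseSpace m} {K : ℝ} (hK0 : 0 ≤ K) (hφ : AEStronglyMeasurable φ volume)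
    (hK : ∀ᵐ z, ‖φ z‖ ≤ K) (hκ : Measurable κ) (hle : Measure.map κ volume ≤ volume) :
    ∃ A : Lp ℂ 2 (volume : Measure (ConfSpace m)) →L[ℂ] Lp ℂ 2 (volume : Measure (PhaseSpace m)),
      (∀ u : 𝓢(ConfSpace m, ℂ),
        A (u.toLp 2 volume) =ᵐ[volume] fun z => φ z * fbiTransform ε u (κ z)) ∧
      ‖A‖ ≤ K * √(fbiNormSq m ε) := by
  have hmem := memLp_mul_fbiTransform_comp hε hφ hK hκ hle
  let f : 𝓢(ConfSpace m, ℂ) →ₗ[ℂ] Lp ℂ 2 (volume : Measure (PhaseSpace m)) :=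
    { toFun := fun u => (hmem u).1.toLp
      map_add' := fun u v => by
        rw [← MemLp.toLp_add]
        refine MemLp.toLp_congr _ _ (Eventually.of_forall fun z => ?_)
        have := fbiTransform_add hε u.integrable v.integrable (κ z)
        simp only [Pi.add_apply]
        rw [← mul_add, ← this]
        rfl
      map_smul' := fun c u => by
        rw [RingHom.id_apply, ← MemLp.toLp_const_smul]
        refine MemLp.toLp_congr _ _ (Eventually.of_forall fun z => ?_)
        have := fbiTransform_const_mul ε c u (κ z)
        simp only [Pi.smul_apply, smul_eq_mul]
        rw [mul_left_comm, ← this]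
        rfl }
  let e : 𝓢(ConfSpace m, ℂ) →ₗ[ℂ] Lp ℂ 2 (volume : Measure (ConfSpace m)) :=
    (SchwartzMap.toLpCLM ℂ ℂ 2 volume).toLinearMap
  have hdense : DenseRange e :=
    SchwartzMap.denseRange_toLpCLM (E := ConfSpace m) (F := ℂ) (p := 2) ENNReal.ofNat_ne_top
  have hC0 : 0 ≤ K * √(fbiNormSq m ε) := by positivity
  have hnorm : ∀ u, ‖f u‖ ≤ K * √(fbiNormSq m ε) * ‖e u‖ := by
    intro u
    change ‖(hmem u).1.toLp‖ ≤ K * √(fbiNormSq m ε) * ‖u.toLp 2 volume‖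
    rw [Lp.norm_toLp, SchwartzMap.norm_toLp, ← ENNReal.toReal_ofReal hC0, ← ENNReal.toReal_mul]
    exact ENNReal.toReal_mono (ENNReal.mul_ne_top ENNReal.ofReal_ne_top
      (u.memLp 2 volume).eLpNorm_ne_top) (hmem u).2
  refine ⟨f.extendOfNorm e, fun u => ?_, LinearMap.opNorm_extendOfNorm_le hdense hC0 hnorm⟩
  have : f.extendOfNorm e (u.toLp 2 volume) = f u :=
    LinearMap.extendOfNorm_eq hdense ⟨_, hnorm⟩ u
  rw [this]
  exact (hmem u).1.coeFn_toLp

theorem ae_norm_le_toReal_eLpNorm_top {X : Type*} [MeasurableSpace X] {μ : Measure X} {f : X → ℂ}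
    (hf : MemLp f ∞ μ) : ∀ᵐ x ∂μ, ‖f x‖ ≤ (eLpNorm f ∞ μ).toReal := by
  have hfin := hf.eLpNorm_ne_top
  rw [eLpNorm_exponent_top] at hfin ⊢
  filter_upwards [ae_le_eLpNormEssSup (f := f) (μ := μ)] with x hx
  simpa using ENNReal.toReal_mono hfin hx

/-- The coherent state centred at `κ z`, multiplied by the unimodular factor `exp(i S(z)/ε)`. -/
noncomputable def phasedCoherentState (ε : ℝ) (S : PhaseSpace m → ℝ)
    (κ : PhaseSpace m → PhaseSpace m) (z : PhaseSpace m) (x : ConfSpace m) : ℂ :=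
  Complex.exp ((S z / ε : ℝ) * Complex.I) * coherentState ε (κ z) x

theorem norm_phasedCoherentState_le_one {ε : ℝ} (hε : 0 < ε) (S : PhaseSpace m → ℝ)
    (κ : PhaseSpace m → PhaseSpace m) (z : PhaseSpace m) (x : ConfSpace m) :
    ‖phasedCoherentState ε S κ z x‖ ≤ 1 := by
  rw [phasedCoherentState, norm_mul, Complex.norm_exp_ofReal_mul_I, one_mul]
  exact norm_coherentState_le_one hε _ _

theorem continuous_phasedCoherentState_right (ε : ℝ) (S : PhaseSpace m → ℝ)
    (κ : PhaseSpace m → PhaseSpace m) (z : PhaseSpace m) :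
    Continuous (phasedCoherentState ε S κ z) :=
  continuous_const.mul (continuous_coherentState_right ε (κ z))

theorem measurable_exp_div_mul_I (ε : ℝ) {S : PhaseSpace m → ℝ} (hS : Measurable S) :
    Measurable fun z => Complex.exp ((S z / ε : ℝ) * Complex.I) :=
  Complex.measurable_exp.comp
    ((Complex.measurable_ofReal.comp (hS.div_const ε)).mul_const Complex.I)

theorem measurable_phasedCoherentState (ε : ℝ) {S : PhaseSpace m → ℝ}
    {κ : PhaseSpace m → PhaseSpace m} (hS : Measurable S) (hκ : Measurable κ) :
    Measurable fun y : PhaseSpace m × ConfSpace m => phasedCoherentState ε S κ y.1 y.2 := by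
  have h1 : Measurable fun y : PhaseSpace m × ConfSpace m => (κ y.1, y.2) :=
    (hκ.comp measurable_fst).prodMk measurable_snd
  have h2 := (continuous_coherentState (m := m) ε).measurable.comp h1
  have h3 : Measurable ((fun z => Complex.exp ((S z / ε : ℝ) * Complex.I)) ∘
      (Prod.fst : PhaseSpace m × ConfSpace m → PhaseSpace m)) :=
    (measurable_exp_div_mul_I ε hS).comp measurable_fst
  exact h3.mul h2

theorem integrable_phasedCoherentState_mul {ε : ℝ} (hε : 0 < ε) {S : PhaseSpace m → ℝ}
    {κ : PhaseSpace m → PhaseSpace m} (hS : Measurable S) (hκ : Measurable κ)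
    {F : PhaseSpace m → ℂ} (hF : Integrable F) (x : ConfSpace m) :
    Integrable fun z => phasedCoherentState ε S κ z x * F z := by
  refine hF.bdd_mul (c := 1) ?_
    (Eventually.of_forall fun z => norm_phasedCoherentState_le_one hε S κ z x)
  have hm : Measurable fun z : PhaseSpace m => (z, x) := measurable_id.prodMk measurable_const
  exact ((measurable_phasedCoherentState ε hS hκ).comp hm).aestronglyMeasurable

theorem continuous_integral_phasedCoherentState_mul {ε : ℝ} (hε : 0 < ε) {S : PhaseSpace m → ℝ}
    {κ : PhaseSpace m → PhaseSpace m} (hS : Measurable S) (hκ : Measurable κ)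
    {F : PhaseSpace m → ℂ} (hF : Integrable F) :
    Continuous fun x => ∫ z, phasedCoherentState ε S κ z x * F z := by
  refine continuous_of_dominated (bound := fun z => ‖F z‖)
    (fun x => (integrable_phasedCoherentState_mul hε hS hκ hF x).aestronglyMeasurable)
    (fun x => Eventually.of_forall fun z => ?_) hF.norm
    (Eventually.of_forall fun z =>
      (continuous_phasedCoherentState_right ε S κ z).mul continuous_const)
  rw [norm_mul]
  exact mul_le_of_le_one_left (norm_nonneg _) (norm_phasedCoherentState_le_one hε S κ z x)

/-- Superposing the coherent states at `κ z` with weights `F z` is the adjoint of the transform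
`v ↦ exp(-i S/ε) · (fbiTransform v) ∘ κ`. -/
theorem integral_mul_integral_phasedCoherentState {ε : ℝ} (hε : 0 < ε) {S : PhaseSpace m → ℝ}
    {κ : PhaseSpace m → PhaseSpace m} (hS : Measurable S) (hκ : Measurable κ)
    {F : PhaseSpace m → ℂ} (hF : Integrable F) {v : ConfSpace m → ℂ} (hv : Integrable v) :
    ∫ x, conj (v x) * ∫ z, phasedCoherentState ε S κ z x * F z
      = ∫ z, conj (conj (Complex.exp ((S z / ε : ℝ) * Complex.I)) * fbiTransform ε v (κ z))
          * F z := by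
  have hv' : Integrable fun x => conj (v x) := by
    simpa using (Complex.conjLIE.toContinuousLinearEquiv : ℂ →L[ℝ] ℂ).integrable_comp hv
  have hprod : Integrable (Function.uncurry fun z x =>
      conj (v x) * (phasedCoherentState ε S κ z x * F z)) (volume.prod volume) := by
    have := (hF.mul_prod hv').bdd_mul (c := 1)
      (measurable_phasedCoherentState ε hS hκ).aestronglyMeasurable
      (Eventually.of_forall fun y => norm_phasedCoherentState_le_one hε S κ y.1 y.2)
    refine this.congr (Eventually.of_forall fun y => ?_)
    simp only [Function.uncurry]
    ring
  calc ∫ x, conj (v x) * ∫ z, phasedCoherentState ε S κ z x * F z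
      = ∫ x, ∫ z, conj (v x) * (phasedCoherentState ε S κ z x * F z) := by
        simp only [integral_const_mul]
    _ = ∫ z, ∫ x, conj (v x) * (phasedCoherentState ε S κ z x * F z) :=
        (integral_integral_swap hprod).symm
    _ = _ := by
        refine integral_congr_ae (Eventually.of_forall fun z => ?_)
        simp only [map_mul, Complex.conj_conj, fbiTransform]
        rw [← integral_conj, ← integral_const_mul, ← integral_mul_const]
        refine integral_congr_ae (Eventually.of_forall fun x => ?_)
        simp only [map_mul, Complex.conj_conj, phasedCoherentState]
        ring

theorem integrable_mul_fbiTransform {ε : ℝ} (hε : 0 < ε) {M : PhaseSpace m → ℂ}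
    (hM : MemLp M ∞ volume) (u : 𝓢(ConfSpace m, ℂ)) :
    Integrable fun z => M z * fbiTransform ε u z :=
  (integrable_fbiTransform hε u).bdd_mul hM.1 (ae_norm_le_toReal_eLpNorm_top hM)

theorem L2_inner_eq_integral {X : Type*} [MeasurableSpace X] {μ : Measure X} {f g : Lp ℂ 2 μ}
    {F G : X → ℂ} (hf : f =ᵐ[μ] F) (hg : g =ᵐ[μ] G) :
    inner ℂ f g = ∫ x, conj (F x) * G x ∂μ := by
  rw [L2.inner_def]
  refine integral_congr_ae ?_
  filter_upwards [hf, hg] with x hx hy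
  rw [hx, hy, RCLike.inner_apply, mul_comm]

theorem norm_adjoint_comp_le {G H : Type*} [NormedAddCommGroup G] [InnerProductSpace ℂ G]
    [CompleteSpace G] [NormedAddCommGroup H] [InnerProductSpace ℂ H] [CompleteSpace H]
    (T S : G →L[ℂ] H) : ‖ContinuousLinearMap.adjoint T ∘L S‖ ≤ ‖T‖ * ‖S‖ := by
  have h : ‖ContinuousLinearMap.adjoint T‖ = ‖T‖ :=
    LinearIsometryEquiv.norm_map ContinuousLinearMap.adjoint T
  exact h ▸ ContinuousLinearMap.opNorm_comp_le (ContinuousLinearMap.adjoint T) S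

/-- The operator is `T₂* T₁`, with `T₁ u = M · fbiTransform u` and
`T₂ v = exp(-i S/ε) · (fbiTransform v) ∘ κ`, each bounded by `√(fbiNormSq m ε)` times the supremum
norm of its multiplier. -/
theorem exists_clm_integral_phasedCoherentState {ε : ℝ} (hε : 0 < ε) {S : PhaseSpace m → ℝ}
    {κ : PhaseSpace m → PhaseSpace m} (hS : Measurable S) (hκ : Measurable κ)
    (hle : Measure.map κ volume ≤ volume) {M : PhaseSpace m → ℂ} (hM : MemLp M ∞ volume) :
    ∃ A : Lp ℂ 2 (volume : Measure (ConfSpace m)) →L[ℂ] Lp ℂ 2 (volume : Measure (ConfSpace m)),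
      (∀ u : 𝓢(ConfSpace m, ℂ), A (u.toLp 2 volume) =ᵐ[volume]
        fun x => ∫ z, phasedCoherentState ε S κ z x * (M z * fbiTransform ε u z)) ∧
      ‖A‖ ≤ fbiNormSq m ε * (eLpNorm M ∞ volume).toReal := by
  obtain ⟨T₁, hT₁, hT₁n⟩ := exists_clm_mul_fbiTransform_comp hε ENNReal.toReal_nonneg hM.1
    (ae_norm_le_toReal_eLpNorm_top hM) measurable_id Measure.map_id.le
  obtain ⟨T₂, hT₂, hT₂n⟩ := exists_clm_mul_fbiTransform_comp (K := 1) hε zero_le_one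
    (φ := fun z => conj (Complex.exp ((S z / ε : ℝ) * Complex.I)))
    (Complex.continuous_conj.measurable.comp (measurable_exp_div_mul_I ε hS)).aestronglyMeasurable
    (Eventually.of_forall fun z => by
      rw [RCLike.norm_conj, Complex.norm_exp_ofReal_mul_I]) hκ hle
  refine ⟨ContinuousLinearMap.adjoint T₂ ∘L T₁, fun u => ?_, ?_⟩
  · have hF := integrable_mul_fbiTransform hε hM u
    refine ae_eq_of_integral_contDiff_smul_eq ((Lp.memLp _).locallyIntegrable (by norm_num))
      (continuous_integral_phasedCoherentState_mul hε hS hκ hF).locallyIntegrable fun g hg hgs => ?_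
    -- both sides are compared by pairing with real test functions
    have hgs' : HasCompactSupport (Complex.ofReal ∘ g) := hgs.comp_left Complex.ofReal_zero
    obtain ⟨v, hv⟩ : ∃ v : 𝓢(ConfSpace m, ℂ), ∀ x, v x = (g x : ℂ) :=
      ⟨hgs'.toSchwartzMap (Complex.ofRealCLM.contDiff.comp hg), fun x => rfl⟩
    have hsmul : ∀ (a : ℂ) x, g x • a = conj (v x) * a := fun a x => by
      rw [hv, Complex.conj_ofReal, Complex.real_smul]
    simp only [hsmul]
    generalize huf : u.toLp 2 volume = f
    have hT₁u : T₁ f =ᵐ[volume] fun z => M z * fbiTransform ε u z := huf ▸ hT₁ u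
    have e1 := L2_inner_eq_integral (v.coeFn_toLp 2 volume)
      (EventuallyEq.refl (ae volume) ((ContinuousLinearMap.adjoint T₂ ∘L T₁) f))
    have e2 := L2_inner_eq_integral (hT₂ v) hT₁u
    have e3 : inner ℂ (v.toLp 2 volume) ((ContinuousLinearMap.adjoint T₂ ∘L T₁) f)
        = inner ℂ (T₂ (v.toLp 2 volume)) (T₁ f) :=
      ContinuousLinearMap.adjoint_inner_right T₂ _ _
    exact e1.symm.trans (e3.trans (e2.trans
      (integral_mul_integral_phasedCoherentState hε hS hκ hF v.integrable).symm))
  · refine (norm_adjoint_comp_le T₂ T₁).trans ?_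
    calc ‖T₂‖ * ‖T₁‖
        ≤ (1 * √(fbiNormSq m ε)) * ((eLpNorm M ∞ volume).toReal * √(fbiNormSq m ε)) := by gcongr
      _ = fbiNormSq m ε * (eLpNorm M ∞ volume).toReal := by
          have := Real.mul_self_sqrt (fbiNormSq_nonneg m hε)
          linear_combination (eLpNorm M ∞ volume).toReal * this

/-! ### The frozen Gaussian operator -/

/-- The phase splits into the action, the outgoing coherent state in `x` and the conjugate of the
incoming coherent state in `y`. -/
theorem fga_integrand_eq (E : Fin 2 → ConfSpace m → ℝ) (i : Fin 2) (t : ℝ) (T : List ℝ) (ε : ℝ)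
    (M : PhaseSpace m → ℂ) (u : ConfSpace m → ℂ) (x y : ConfSpace m) (z : PhaseSpace m) :
    Complex.exp (Complex.I / (ε : ℂ) * fgaPhase E i t T x y z) * M z * u y
      = (Complex.exp ((fgaAction E i t T z / ε : ℝ) * Complex.I)
          * coherentState ε (fgaMap E i t T z) x * M z) * (conj (coherentState ε z y) * u y) := by
  have hconj : conj (coherentState ε z y) = Complex.exp (Complex.I / (ε : ℂ)
      * (Complex.I / 2 * ((‖y - z.1‖ ^ 2 : ℝ) : ℂ) - ((inner ℝ z.2 (y - z.1) : ℝ) : ℂ))) := by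
    rw [coherentState, ← Complex.exp_conj]
    have h2 : conj (2 : ℂ) = 2 := map_ofNat _ 2
    simp only [map_mul, map_add, map_div₀, Complex.conj_I, Complex.conj_ofReal, h2]
    ring_nf
  have hexp : Complex.exp (Complex.I / (ε : ℂ) * fgaPhase E i t T x y z)
      = Complex.exp ((fgaAction E i t T z / ε : ℝ) * Complex.I)
          * coherentState ε (fgaMap E i t T z) x * conj (coherentState ε z y) := by
    rw [hconj, coherentState, ← Complex.exp_add, ← Complex.exp_add]
    congr 1
    rw [fgaPhase]
    push_cast
    ring
  rw [hexp]
  ring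

theorem fgaInner_eq (E : Fin 2 → ConfSpace m → ℝ) (i : Fin 2) (t : ℝ) (T : List ℝ) (ε : ℝ)
    (M : PhaseSpace m → ℂ) (u : ConfSpace m → ℂ) (x : ConfSpace m) (z : PhaseSpace m) :
    fgaInner E i t T ε M u x z = phasedCoherentState ε (fgaAction E i t T) (fgaMap E i t T) z x
      * (M z * fbiTransform ε u z) := by
  simp only [fgaInner, fga_integrand_eq, fbiTransform, phasedCoherentState]
  rw [integral_const_mul]
  ring

end CoherentState

theorem proposition6p4 {m : ℕ}
    -- the two energy surfaces and their common subquadratic bound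
    (E : Fin 2 → ConfSpace m → ℝ) (C : ℝ) (hE : ∀ k, IsSubquadratic (E k) C)
    -- the initial surface, the time, and the ordered hopping times
    (i : Fin 2) (t : ℝ) (ht : 0 ≤ t)
    (T : List ℝ) (hT : ∀ s ∈ T, 0 ≤ s) (hTord : T.Pairwise (· ≤ ·))
    (ε : ℝ) (hε : 0 < ε)
    (M : PhaseSpace m → ℂ) (hM : MemLp M ∞ (volume : Measure (PhaseSpace m))) :
    -- the iterated integral that defines the operator on Schwartz functions converges absolutely
    (∀ (u : 𝓢(ConfSpace m, ℂ)) (x : ConfSpace m),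
      (∀ z : PhaseSpace m, Integrable (fun y : ConfSpace m =>
        Complex.exp (Complex.I / (ε : ℂ) * fgaPhase E i t T x y z) * M z * u y) volume) ∧
      Integrable (fun z : PhaseSpace m => fgaInner E i t T ε M u x z) volume) ∧
    -- the operator extends to a bounded linear operator on `L²`, with the norm bound
    ∃ A : Lp ℂ 2 (volume : Measure (ConfSpace m)) →L[ℂ] Lp ℂ 2 (volume : Measure (ConfSpace m)),
      (∀ u : 𝓢(ConfSpace m, ℂ),
        (A (u.toLp 2 volume) : ConfSpace m → ℂ) =ᵐ[volume] fgaFIO E i t T ε M u) ∧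
      ‖A‖ ≤ (2 : ℝ) ^ (-((m : ℝ) / 2)) * (eLpNorm M ∞ (volume : Measure (PhaseSpace m))).toReal := by
  obtain ⟨hκ, hS, hle⟩ := fgaMap_measurable_and_map_le hE i t T
  refine ⟨fun u x => ⟨fun z => ?_, ?_⟩, ?_⟩
  · simp only [fga_integrand_eq]
    exact (integrable_conj_coherentState_mul hε u.integrable z).const_mul _
  · simp only [fgaInner_eq]
    exact integrable_phasedCoherentState_mul hε hS hκ (integrable_mul_fbiTransform hε hM u) x
  obtain ⟨A, hA, hAn⟩ := exists_clm_integral_phasedCoherentState hε hS hκ hle hM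
  set c : ℝ := (2 * Real.pi * ε) ^ (-(3 * (m : ℝ) / 2)) with hc
  have hc0 : 0 ≤ c := by have := Real.pi_pos; positivity
  refine ⟨(c : ℂ) • A, fun u => ?_, ?_⟩
  · have hsmul : ((c : ℂ) • A) (u.toLp 2 volume) = (c : ℂ) • A (u.toLp 2 volume) := rfl
    rw [hsmul]
    filter_upwards [Lp.coeFn_smul (c : ℂ) (A (u.toLp 2 volume)), hA u] with x h1 h2
    rw [h1, Pi.smul_apply, h2, smul_eq_mul, fgaFIO]
    simp only [fgaInner_eq, hc]
  · rw [norm_smul, Complex.norm_real, Real.norm_of_nonneg hc0, ← rpow_mul_fbiNormSq m hε, mul_assoc]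
    exact mul_le_mul_of_nonneg_left hAn hc0
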